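/- Let $\mathcal F$ be a holomorphic foliation of degree $d$ of the complex projective plane $\mathbb P^2$, i.e. the foliation whose leaves are the projections of the complex trajectories of a vector field $F_0\partial_{z_0}+F_1\partial_{z_1}+F_2\partial_{z_2}$ on $\mathbb C^3$, where $F_0,F_1,F_2$ are homogeneous polynomials of degree $d$ without common factor; its singular points are the points $[v]$ for which $F(v)$ is collinear with $v$. Assume that every singular point $p$ of $\mathcal F$ is hyperbolic: the two eigenvalues $\lambda_1,\lambda_2$ at $p$ of the linear part of the vector field that defines $\mathcal F$ in an affine chart around $p$ (in the chart $z_i=1$, the field $\sum_{j\ne i}(F_j-z_jF_i)\,\partial_{z_j}$) are nonzero and $\lambda_1/\lambda_2\notin\mathbb R$. Call an algebraic curve invariant if, outside the singular points, it is a union of leaves of $\mathcal F$. Then $\mathcal F$ has only finitely many irreducible invariant algebraic curves $A_i$, and $$\sum_i \deg(A_i)\le 2(d+2).$$ -/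

import Mathlib

open scoped LinearAlgebra.Projectivization

/-- The complex projective plane: lines through the origin of `ℂ³`. -/
abbrev P2 : Type := ℙ ℂ (Fin 3 → ℂ)

/-- The zero set in the projective plane of a (homogeneous) polynomial. -/
def projZeroLocus (h : MvPolynomial (Fin 3) ℂ) : Set P2 :=
  {p | ∀ v ∈ p.submodule, MvPolynomial.eval v h = 0}

/-- Irreducible algebraic curves of the projective plane, as sets of points. -/
def IsIrreducibleCurve (C : Set P2) : Prop :=
  ∃ (n : ℕ) (h : MvPolynomial (Fin 3) ℂ),
    h.IsHomogeneous n ∧ Irreducible h ∧ projZeroLocus h = C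

/-- The degree of an algebraic curve: the least degree of a nonzero homogeneous polynomial
whose zero set is the curve (attained by the reduced equation of the curve). -/
noncomputable def curveDegree (C : Set P2) : ℕ :=
  sInf {n | ∃ h : MvPolynomial (Fin 3) ℂ, h ≠ 0 ∧ h.IsHomogeneous n ∧ projZeroLocus h = C}

/-- A foliation of degree `d` of the projective plane, given by a homogeneous polynomial vector
field `F₀ ∂/∂z₀ + F₁ ∂/∂z₁ + F₂ ∂/∂z₂` of degree `d` on `ℂ³` without common factor. -/
structure PlaneFoliation (d : ℕ) where
  /-- the components of the vector field -/
  comp : Fin 3 → MvPolynomial (Fin 3) ℂ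
  /-- they are homogeneous of degree `d` -/
  homogeneous : ∀ i, (comp i).IsHomogeneous d
  /-- they have no common factor -/
  no_common_factor : ∀ g : MvPolynomial (Fin 3) ℂ, (∀ i, g ∣ comp i) → IsUnit g

namespace PlaneFoliation

variable {d : ℕ} (F : PlaneFoliation d)

/-- The vector field on `ℂ³`. -/
noncomputable def field (v : Fin 3 → ℂ) : Fin 3 → ℂ :=
  fun i => MvPolynomial.eval v (F.comp i)

/-- The singular set: the points `p = [v]` for which `F(v)` is collinear with `v`. -/
def Sing : Set P2 :=
  {p | ∀ v ∈ p.submodule, F.field v ∈ p.submodule}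

/-- The point of `ℂ³` with `i`-th coordinate `1` and with the other coordinates `w`, in order. -/
def chartPoint (i : Fin 3) (w : Fin 2 → ℂ) : Fin 3 → ℂ :=
  Fin.insertNth (α := fun _ => ℂ) i 1 w

/-- The vector field `∑_{j ≠ i} (F_j - z_j F_i) ∂/∂z_j` that defines the foliation in the affine
chart `z_i = 1`. -/
noncomputable def chartField (i : Fin 3) (w : Fin 2 → ℂ) : Fin 2 → ℂ :=
  fun k => F.field (chartPoint i w) (i.succAbove k) - w k * F.field (chartPoint i w) i

/-- The two eigenvalues (with multiplicity) of the linear map are nonzero and their quotient is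
not real. -/
def IsHyperbolicLinear (T : (Fin 2 → ℂ) →ₗ[ℂ] (Fin 2 → ℂ)) : Prop :=
  ∃ l₁ l₂ : ℂ, T.charpoly.roots = {l₁, l₂} ∧ l₁ ≠ 0 ∧ l₂ ≠ 0 ∧ (l₁ / l₂).im ≠ 0

/-- Hyperbolicity of the foliation at a singular point `p`: the linear part at `p` of the vector
field defining the foliation in an affine chart around `p` is hyperbolic. (Whether this holds
does not depend on the chart.) -/
def IsHyperbolicAt (p : P2) : Prop :=
  ∀ (i : Fin 3) (w : Fin 2 → ℂ), chartPoint i w ∈ p.submodule →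
    IsHyperbolicLinear (fderiv ℂ (F.chartField i) w : (Fin 2 → ℂ) →ₗ[ℂ] (Fin 2 → ℂ))

/-- All singular points of the foliation are hyperbolic. -/
def HasOnlyHyperbolicSingularities : Prop :=
  ∀ p ∈ F.Sing, F.IsHyperbolicAt p

/-- Plaques: projections to the plane of holomorphic trajectories `z' = F(z)` over discs, outside
the singular set. -/
def IsPlaque (S : Set P2) : Prop :=
  ∃ (r : ℝ) (z : ℂ → Fin 3 → ℂ), 0 < r ∧
    (∀ t ∈ Metric.ball (0 : ℂ) r, z t ≠ 0 ∧ HasDerivAt z (F.field (z t)) t) ∧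
    S = {p | ∃ t ∈ Metric.ball (0 : ℂ) r, z t ∈ p.submodule} ∧
    Disjoint S F.Sing

/-- The leaf through `p` (a nonsingular point): the points that can be reached from `p` along a
finite chain of plaques, each plaque meeting the next one. -/
def leaf (p : P2) : Set P2 :=
  {q | Relation.TransGen (fun a b => ∃ S, F.IsPlaque S ∧ a ∈ S ∧ b ∈ S) p q}

/-- A set is invariant when it is, outside the singular set, a union of leaves. -/
def IsInvariant (C : Set P2) : Prop :=
  ∃ T : Set P2, C \ F.Sing = ⋃ p ∈ T, F.leaf p

/-- The set of irreducible algebraic curves that are invariant under the foliation. -/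
def invariantCurves : Set (Set P2) :=
  {C | IsIrreducibleCurve C ∧ F.IsInvariant C}

end PlaneFoliation

/-! The argument gives the total degree bound `d + 2`, half of the stated one. Let `H` be the
product of the irreducible equations of finitely many invariant curves, of degree `n`.
Differentiating along trajectories and applying the Nullstellensatz shows that each equation divides
its derivative along `F`, hence `F·∇H = K H` for some polynomial `K` (`dvd_field_gradient`,
`prod_dvd_derivation_prod`). Since `H` is squarefree, everything reduces to
`degree_le_of_invariant`; a bound on `n` also bounds the number of curves.

Local part. Where `∇H` vanishes the foliation is singular (`exists_parallel_of_gradient_eq_zero`),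
hence hyperbolic, and there the curve has an ordinary node. To see this, restrict `H` to polynomial
approximations of the two separatrices: the leading exponents satisfy equations that determine the
value of the cofactor at the point (`weight_of_separatrix`). As the eigenvalues are independent over
the reals, the two answers agree only when this value is `l₁ + l₂`, which forces the quadratic part
of `H` to be a nonzero multiple of `xy` (`hessian_of_hyperbolic`). At such a point a polynomial that
vanishes there is `O(‖∇H‖)`. This applies to the components of `P = z × F`, of degree `d + 1`, which
vanish at the singular points; compactness and homogeneity make the estimate global
(`exists_norm_le_gradient`).

Global part. On `H = 0` the vectors `P` and `∇H` are parallel (`minorPoly_mul_pderiv`), so for a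
direction `a` the quotient `(a·P)/(a·∇H)` is a function on the curve, homogeneous of degree `d + 2 -
n` and controlled by the matching power of the norm. If `n > d + 2`, it decays at least like the
inverse of the norm. Multiplying its values over the points of the curve on a moving line through
`[a]` gives a ratio of resultants, that is, a rational function of one variable which is bounded and
tends to zero at infinity, hence zero (`eq_zero_of_norm_mul_le`). Then `H` and `a·P` would share a
component, and that component would consist of singular points; but hyperbolic singular points are
isolated (`not_forall_dvd_minorPoly`). -/

/-! ### Elimination over a factorial domain -/

/-- Two polynomials over a factorial domain without common irreducible factor of positive degree
generate an ideal that contains a nonzero constant. -/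
theorem exists_combination_eq_C {R : Type*} [CommRing R] [IsDomain R]
    [UniqueFactorizationMonoid R] (p q : Polynomial R) (hp : p ≠ 0)
    (h : ∀ f : Polynomial R, Irreducible f → 0 < f.natDegree → f ∣ p → ¬ f ∣ q) :
    ∃ r : R, r ≠ 0 ∧ ∃ a b : Polynomial R, a * p + b * q = Polynomial.C r := by
  classical
  let _ : StrongNormalizationMonoid R :=
    UniqueFactorizationMonoid.strongNormalizationMonoid
  let _ : NormalizedGCDMonoid R := UniqueFactorizationMonoid.toNormalizedGCDMonoid R
  let K := FractionRing R
  have hinj : Function.Injective (algebraMap R K) := IsFractionRing.injective R K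
  -- Over the fraction field, polynomials form a principal ideal domain, so a failure of coprimality
  -- would give a common irreducible factor `P`. Clearing denominators and taking the primitive part
  -- brings `P` back to `R[X]` by Gauss's lemma.
  have hcop : IsCoprime (p.map (algebraMap R K)) (q.map (algebraMap R K)) := by
    apply isCoprime_of_irreducible_dvd
    · rintro ⟨h1, -⟩
      exact hp ((Polynomial.map_eq_zero_iff hinj).1 h1)
    · intro P hP hPp hPq
      obtain ⟨b, hb, hbP⟩ :=
        IsLocalization.integerNormalization_spec (nonZeroDivisors R) (S := K) P
      set P₀ := IsLocalization.integerNormalization (nonZeroDivisors R) P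
      have hb0 : algebraMap R K b ≠ 0 :=
        fun h0 => nonZeroDivisors.ne_zero hb (hinj (by simpa using h0))
      have hP₀ : P₀ ≠ 0 := by
        intro h0
        rw [h0, Polynomial.map_zero] at hbP
        rcases smul_eq_zero.1 hbP.symm with h1 | h1
        · exact nonZeroDivisors.ne_zero hb h1
        · exact hP.ne_zero h1
      have hc0 : algebraMap R K P₀.content ≠ 0 := by
        intro h0
        exact hP₀ (Polynomial.content_eq_zero_iff.1 (hinj (by simpa using h0)))
      have hmap : Polynomial.C (algebraMap R K P₀.content) *
          P₀.primPart.map (algebraMap R K) = Polynomial.C (algebraMap R K b) * P := by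
        rw [← Polynomial.map_C, ← Polynomial.map_mul, ← Polynomial.eq_C_content_mul_primPart, hbP,
          ← Polynomial.smul_eq_C_mul, algebraMap_smul]
      have hass : Associated (P₀.primPart.map (algebraMap R K)) P := by
        have u1 : IsUnit (Polynomial.C (algebraMap R K P₀.content)) :=
          Polynomial.isUnit_C.2 (isUnit_iff_ne_zero.2 hc0)
        have u2 : IsUnit (Polynomial.C (algebraMap R K b)) :=
          Polynomial.isUnit_C.2 (isUnit_iff_ne_zero.2 hb0)
        have h1 := associated_unit_mul_left (P₀.primPart.map (algebraMap R K)) _ u1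
        have h2 := associated_unit_mul_left P _ u2
        rw [hmap] at h1
        exact h1.symm.trans h2
      have hprim := P₀.isPrimitive_primPart
      have hirr : Irreducible P₀.primPart :=
        (hprim.irreducible_iff_irreducible_map_fraction_map (K := K)).2 (hass.symm.irreducible hP)
      have hdeg : 0 < P₀.primPart.natDegree := by
        have h1 : (P₀.primPart.map (algebraMap R K)).natDegree = P₀.primPart.natDegree :=
          Polynomial.natDegree_map_eq_of_injective hinj _
        rw [← h1, Polynomial.natDegree_eq_of_degree_eq (Polynomial.degree_eq_degree_of_associated hass)]
        exact hP.natDegree_pos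
      exact h _ hirr hdeg
        (hprim.dvd_of_fraction_map_dvd_fraction_map (K := K) (hass.dvd.trans hPp))
        (hprim.dvd_of_fraction_map_dvd_fraction_map (K := K) (hass.dvd.trans hPq))
  -- The constant is the product of the denominators in the Bézout relation.
  obtain ⟨a, b, hab⟩ := hcop
  obtain ⟨ra, hra, ha⟩ := IsLocalization.integerNormalization_spec (nonZeroDivisors R) (S := K) a
  obtain ⟨rb, hrb, hb⟩ := IsLocalization.integerNormalization_spec (nonZeroDivisors R) (S := K) b
  refine ⟨ra * rb, mul_ne_zero (nonZeroDivisors.ne_zero hra) (nonZeroDivisors.ne_zero hrb),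
    Polynomial.C rb * IsLocalization.integerNormalization (nonZeroDivisors R) a,
    Polynomial.C ra * IsLocalization.integerNormalization (nonZeroDivisors R) b, ?_⟩
  apply Polynomial.map_injective _ hinj
  have ha' : ra • a = Polynomial.C (algebraMap R K ra) * a := by
    rw [← Polynomial.smul_eq_C_mul, algebraMap_smul]
  have hb' : rb • b = Polynomial.C (algebraMap R K rb) * b := by
    rw [← Polynomial.smul_eq_C_mul, algebraMap_smul]
  simp only [Polynomial.map_add, Polynomial.map_mul, Polynomial.map_C, ha, hb, map_mul, ha', hb']
  linear_combination (Polynomial.C (algebraMap R K ra) * Polynomial.C (algebraMap R K rb)) * hab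

/-- A squarefree polynomial in characteristic zero has no irreducible factor of positive degree in
common with its derivative. -/
theorem not_dvd_derivative_of_squarefree {R : Type*} [CommRing R] [IsDomain R] [CharZero R]
    [UniqueFactorizationMonoid R] {p f : Polynomial R} (hp : Squarefree p) (hf : Irreducible f)
    (hdeg : 0 < f.natDegree) (hfp : f ∣ p) : ¬ f ∣ Polynomial.derivative p := by
  rintro hd
  obtain ⟨g, rfl⟩ := hfp
  rw [Polynomial.derivative_mul, dvd_add_left (dvd_mul_right _ _)] at hd
  rcases hf.prime.dvd_or_dvd hd with h | h
  · have h0 : Polynomial.derivative f = 0 := by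
      apply Polynomial.eq_zero_of_dvd_of_natDegree_lt h
      exact Polynomial.natDegree_derivative_lt hdeg.ne'
    exact hdeg.ne' (Polynomial.derivative_eq_zero.1 h0)
  · exact hf.not_isUnit (hp f (mul_dvd_mul_left f h))

/-! ### One variable: singular linear equations and growth at infinity -/

/-- Vanishing to high order of approximate solutions of the singular linear equation
`A g' = B g`, with `A` vanishing at the origin. -/
theorem X_pow_dvd_of_singular_ode {N : ℕ} {A B g : Polynomial ℂ} (hA : A.coeff 0 = 0)
    (h : Polynomial.X ^ N ∣ A * Polynomial.derivative g - B * g)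
    (hg : ∀ e : ℕ, B.coeff 0 = e * A.coeff 1 → g.coeff e = 0) : Polynomial.X ^ N ∣ g := by
  rw [Polynomial.X_pow_dvd_iff]
  intro d
  induction d using Nat.strong_induction_on with
  | _ d ih =>
    intro hd
    by_cases hB : B.coeff 0 = d * A.coeff 1
    · exact hg d hB
    -- With `g = x ^ d * g₁`, the coefficient of `x ^ d` in `A g' - B g` is `(d * A₁(0) - B(0)) *
    -- g₁(0)`, where `A = x * A₁`; away from resonance this forces `g₁(0) = 0`.
    · obtain ⟨g₁, rfl⟩ : Polynomial.X ^ d ∣ g :=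
        Polynomial.X_pow_dvd_iff.2 fun e he => ih e he (he.trans hd)
      obtain ⟨A₁, rfl⟩ := Polynomial.X_dvd_iff.2 hA
      have h1 : Polynomial.X * A₁ * Polynomial.derivative (Polynomial.X ^ d * g₁)
          - B * (Polynomial.X ^ d * g₁)
          = Polynomial.X ^ d * (A₁ * Polynomial.C (d : ℂ) * g₁
            + Polynomial.X * (A₁ * Polynomial.derivative g₁) - B * g₁) := by
        have h2 : Polynomial.X * Polynomial.derivative ((Polynomial.X : Polynomial ℂ) ^ d)
            = Polynomial.C (d : ℂ) * Polynomial.X ^ d := by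
          rcases d with _ | d
          · simp
          · rw [Polynomial.derivative_X_pow]
            simp only [Nat.add_sub_cancel]
            ring
        rw [Polynomial.derivative_mul]
        linear_combination A₁ * g₁ * h2
      have h3 := Polynomial.X_pow_dvd_iff.1 h d hd
      rw [h1] at h3
      have hc := Polynomial.coeff_X_pow_mul (R := ℂ)
      have h4 := fun p : Polynomial ℂ => hc p d 0
      simp only [zero_add] at h4
      rw [h4] at h3 ⊢
      have h5 : (d * A₁.coeff 0 - B.coeff 0) * g₁.coeff 0 = 0 := by
        simp only [Polynomial.coeff_add, Polynomial.coeff_sub, Polynomial.mul_coeff_zero,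
          Polynomial.coeff_X_zero, Polynomial.coeff_C_zero] at h3
        linear_combination h3
      have h6 : (Polynomial.X * A₁).coeff 1 = A₁.coeff 0 := by
        simp
      rw [h6] at hB
      rcases mul_eq_zero.1 h5 with h7 | h7
      · exact absurd (by linear_combination -h7) hB
      · exact h7

/-- A polynomial whose quotient by another one is bounded and tends to zero at infinity is zero. -/
theorem eq_zero_of_norm_mul_le (n : ℕ) (P Q : Polynomial ℂ) (C : ℝ) (hn : Q.natDegree = n)
    (hQ : Q ≠ 0)
    (h : ∀ x, Q.eval x ≠ 0 → (1 + ‖x‖) * ‖P.eval x‖ ≤ C * ‖Q.eval x‖) : P = 0 := by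
  -- By continuity the bound extends over a finite exceptional set.
  have hall : ∀ (P Q : Polynomial ℂ) (S : Set ℂ), S.Finite →
      (∀ x, x ∉ S → (1 + ‖x‖) * ‖P.eval x‖ ≤ C * ‖Q.eval x‖) →
      ∀ x, (1 + ‖x‖) * ‖P.eval x‖ ≤ C * ‖Q.eval x‖ := by
    intro P Q S hS hle x
    have hd : Dense Sᶜ := by
      simpa [Set.compl_eq_univ_sdiff] using (dense_univ (X := ℂ)).sdiff_finite hS
    have hcl : IsClosed {x : ℂ | (1 + ‖x‖) * ‖P.eval x‖ ≤ C * ‖Q.eval x‖} :=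
      isClosed_le (by fun_prop) (by fun_prop)
    exact hcl.closure_subset_iff.2 (fun x hx => hle x hx) (hd x)
  have h' : ∀ x, (1 + ‖x‖) * ‖P.eval x‖ ≤ C * ‖Q.eval x‖ := by
    refine hall P Q {x | Q.eval x = 0} ?_ h
    exact (Polynomial.finite_setOfPred_isRoot hQ)
  clear h
  -- At a root of `Q` the bound forces `P` to vanish as well, so the linear factor cancels from
  -- both. For constant `Q` the bound makes `X * P` a bounded polynomial without constant term.
  induction n generalizing P Q with
  | zero =>
    by_contra hP
    rw [Polynomial.eq_C_of_natDegree_eq_zero hn] at h'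
    have hdeg : 0 < (Polynomial.X * P).degree := by
      rw [Polynomial.degree_mul, Polynomial.degree_X]
      have := Polynomial.zero_le_degree_iff.2 hP
      exact add_pos_of_pos_of_nonneg (by norm_num) this
    have ht := Polynomial.tendsto_norm_atTop (Polynomial.X * P) hdeg
      (l := Filter.comap (fun x : ℂ => ‖x‖) Filter.atTop) (z := id) Filter.tendsto_comap
    have hne : (Filter.comap (fun x : ℂ => ‖x‖) Filter.atTop).NeBot := by
      rw [comap_norm_atTop]
      infer_instance
    obtain ⟨x, hx⟩ := (ht.eventually_gt_atTop (C * ‖Q.coeff 0‖)).exists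
    have h2 := h' x
    simp only [id, Polynomial.eval_mul, Polynomial.eval_X, norm_mul, Polynomial.eval_C] at hx h2
    nlinarith [norm_nonneg (P.eval x)]
  | succ n ih =>
    obtain ⟨a, ha⟩ : ∃ a, Q.IsRoot a := by
      apply Complex.exists_root
      rw [Polynomial.degree_eq_natDegree hQ, hn]
      exact_mod_cast Nat.succ_pos n
    obtain ⟨Q₁, rfl⟩ := Polynomial.dvd_iff_isRoot.2 ha
    have hQ₁ : Q₁ ≠ 0 := right_ne_zero_of_mul hQ
    have hdeg : Q₁.natDegree = n := by
      rw [Polynomial.natDegree_mul (Polynomial.X_sub_C_ne_zero a) hQ₁,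
        Polynomial.natDegree_X_sub_C] at hn
      omega
    obtain ⟨P₁, rfl⟩ : (Polynomial.X - Polynomial.C a) ∣ P := by
      rw [Polynomial.dvd_iff_isRoot, Polynomial.IsRoot, ← norm_eq_zero]
      have h1 := h' a
      rw [ha.eq_zero, norm_zero, mul_zero] at h1
      nlinarith [norm_nonneg (P.eval a), norm_nonneg a]
    rw [ih P₁ Q₁ hdeg hQ₁ (hall P₁ Q₁ {a} (by simp) fun x hx => ?_), mul_zero]
    have hxa : 0 < ‖x - a‖ := norm_pos_iff.2 (sub_ne_zero.2 hx)
    have h3 := h' x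
    simp only [Polynomial.eval_mul, Polynomial.eval_X, Polynomial.eval_sub, Polynomial.eval_C,
      norm_mul] at h3
    refine le_of_mul_le_mul_left ?_ hxa
    linarith

/-! ### Restriction to graphs and approximate separatrices -/

/-- First order Taylor expansion in one variable of a polynomial in several variables. -/
theorem exists_aeval_update_add {σ B : Type*} [DecidableEq σ] [CommRing B] [Algebra ℂ B]
    (p : MvPolynomial σ ℂ) (g : σ → B) (i : σ) (s u : B) :
    ∃ r, MvPolynomial.aeval (Function.update g i (s + u)) p =
      MvPolynomial.aeval (Function.update g i s) p
      + u * MvPolynomial.aeval (Function.update g i s) (MvPolynomial.pderiv i p) + u ^ 2 * r := by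
  induction p using MvPolynomial.induction_on with
  | C a => exact ⟨0, by simp [← MvPolynomial.algebraMap_eq]⟩
  | add p q hp hq =>
    obtain ⟨r₁, h₁⟩ := hp
    obtain ⟨r₂, h₂⟩ := hq
    refine ⟨r₁ + r₂, ?_⟩
    simp only [map_add, h₁, h₂]
    ring
  | mul_X p j hp =>
    obtain ⟨r, hr⟩ := hp
    by_cases hj : j = i
    · subst hj
      refine ⟨MvPolynomial.aeval (Function.update g j s) (MvPolynomial.pderiv j p)
        + r * (s + u), ?_⟩
      simp only [map_mul, hr, MvPolynomial.aeval_X, Function.update_self, Derivation.leibniz,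
        MvPolynomial.pderiv_X_self, map_add, smul_eq_mul, mul_one]
      ring
    · refine ⟨r * g j, ?_⟩
      simp only [map_mul, hr, MvPolynomial.aeval_X, Function.update_of_ne hj, Derivation.leibniz,
        MvPolynomial.pderiv_X_of_ne hj, smul_eq_mul, mul_zero, zero_add]
      ring

/-- The chain rule for derivations of polynomial expressions. -/
theorem derivation_aeval {σ B : Type*} [Fintype σ] [CommRing B] [Algebra ℂ B]
    (D : Derivation ℂ B B) (g : σ → B) (p : MvPolynomial σ ℂ) :
    D (MvPolynomial.aeval g p) =
      ∑ i, MvPolynomial.aeval g (MvPolynomial.pderiv i p) * D (g i) := by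
  classical
  induction p using MvPolynomial.induction_on with
  | C a => simp [← MvPolynomial.algebraMap_eq]
  | add p q hp hq => simp only [map_add, hp, hq, add_mul, Finset.sum_add_distrib]
  | mul_X p j hp =>
    simp only [map_mul, Derivation.leibniz, hp, MvPolynomial.aeval_X, smul_eq_mul,
      MvPolynomial.pderiv_X, map_add, add_mul, Finset.sum_add_distrib, Finset.mul_sum]
    congr 1
    · rw [Finset.sum_eq_single j]
      · simp
      · intro b _ hb
        simp [hb.symm]
      · simp
    · refine Finset.sum_congr rfl fun i _ => ?_
      ring

/-- Restriction of a polynomial in two variables to the parametrized curve whose `i`-th coordinate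
is `s` and whose other coordinate is the parameter. -/
noncomputable def branch (i : Fin 2) (s : Polynomial ℂ) :
    MvPolynomial (Fin 2) ℂ →ₐ[ℂ] Polynomial ℂ :=
  MvPolynomial.aeval (Function.update (fun _ => Polynomial.X) i s)

theorem sum_fin_two_of_ne {M : Type*} [AddCommMonoid M] {i j : Fin 2} (hij : i ≠ j) (f : Fin 2 → M) :
    ∑ l, f l = f i + f j := by
  fin_cases i <;> fin_cases j <;> simp_all [add_comm]

theorem derivative_branch {i j : Fin 2} (hij : i ≠ j) (s : Polynomial ℂ)
    (p : MvPolynomial (Fin 2) ℂ) :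
    Polynomial.derivative (branch i s p) =
      Polynomial.derivative s * branch i s (MvPolynomial.pderiv i p)
        + branch i s (MvPolynomial.pderiv j p) := by
  have h := derivation_aeval Polynomial.derivative'
    (Function.update (fun _ => Polynomial.X) i s) p
  rw [sum_fin_two_of_ne hij] at h
  simp only [Polynomial.derivative'_apply, Function.update_self, Function.update_of_ne hij.symm,
    Polynomial.derivative_X, mul_one] at h
  rw [branch, h, mul_comm]

theorem coeff_zero_branch {i : Fin 2} {s : Polynomial ℂ} (hs : s.coeff 0 = 0)
    (p : MvPolynomial (Fin 2) ℂ) : (branch i s p).coeff 0 = MvPolynomial.eval 0 p := by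
  have h : (Polynomial.aeval (0 : ℂ)).comp (branch i s) = MvPolynomial.aeval (0 : Fin 2 → ℂ) := by
    apply MvPolynomial.algHom_ext
    intro l
    by_cases hl : l = i
    · subst hl
      simp [branch, ← Polynomial.coeff_zero_eq_eval_zero, hs]
    · simp [branch, Function.update_of_ne hl]
  have h1 := DFunLike.congr_fun h p
  rw [AlgHom.comp_apply, Polynomial.coe_aeval_eq_eval] at h1
  rw [Polynomial.coeff_zero_eq_eval_zero]
  simpa [MvPolynomial.aeval_eq_eval] using h1

theorem coeff_one_branch {i j : Fin 2} (hij : i ≠ j) {s : Polynomial ℂ} (hs : s.coeff 0 = 0)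
    (hs' : s.coeff 1 = 0) (p : MvPolynomial (Fin 2) ℂ) :
    (branch i s p).coeff 1 = MvPolynomial.eval 0 (MvPolynomial.pderiv j p) := by
  have h : (branch i s p).coeff 1 = (Polynomial.derivative (branch i s p)).coeff 0 := by
    simp [Polynomial.coeff_derivative]
  rw [h, derivative_branch hij, Polynomial.coeff_add, Polynomial.mul_coeff_zero,
    coeff_zero_branch hs, coeff_zero_branch hs, Polynomial.coeff_derivative, zero_add, hs',
    zero_mul, zero_mul, zero_add]

/-- Approximate separatrices, to any order, of a nonresonant singular point. -/
theorem exists_approximate_separatrix {i j : Fin 2} (hij : i ≠ j) (X Y : MvPolynomial (Fin 2) ℂ)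
    {l₁ l₂ : ℂ} (hX : MvPolynomial.eval 0 X = 0) (hY : MvPolynomial.eval 0 Y = 0)
    (hXi : MvPolynomial.eval 0 (MvPolynomial.pderiv i X) = l₁)
    (hXj : MvPolynomial.eval 0 (MvPolynomial.pderiv j X) = 0)
    (hYj : MvPolynomial.eval 0 (MvPolynomial.pderiv j Y) = l₂)
    (hres : ∀ n : ℕ, (n : ℂ) * l₂ ≠ l₁) (N : ℕ) :
    ∃ s : Polynomial ℂ, s.coeff 0 = 0 ∧ s.coeff 1 = 0 ∧
      Polynomial.X ^ N ∣ Polynomial.derivative s * branch i s Y - branch i s X := by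
  -- Order two is where the induction can start from `s = 0`: on the `j`-th axis `X` has neither
  -- constant nor linear term.
  suffices h : ∀ N : ℕ, ∃ s : Polynomial ℂ, s.coeff 0 = 0 ∧ s.coeff 1 = 0 ∧
      Polynomial.X ^ (N + 2) ∣ Polynomial.derivative s * branch i s Y - branch i s X by
    obtain ⟨s, h0, h1, hs⟩ := h N
    exact ⟨s, h0, h1, (pow_dvd_pow _ (by omega)).trans hs⟩
  clear N
  intro N
  induction N with
  | zero =>
    refine ⟨0, by simp, by simp, ?_⟩
    rw [Polynomial.X_pow_dvd_iff]
    intro d hd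
    have : d = 0 ∨ d = 1 := by omega
    rcases this with rfl | rfl
    · rw [Polynomial.derivative_zero, zero_mul, zero_sub, Polynomial.coeff_neg,
        coeff_zero_branch (by simp), hX, neg_zero]
    · rw [Polynomial.derivative_zero, zero_mul, zero_sub, Polynomial.coeff_neg,
        coeff_one_branch hij (by simp) (by simp), hXj, neg_zero]
  | succ N ih =>
    obtain ⟨s, hs0, hs1, E, hE⟩ := ih
    have hd : (((N + 2 : ℕ) : ℂ) * l₂ - l₁) ≠ 0 := sub_ne_zero.2 (hres _)
    -- Adding `c x ^ (N + 2)` to `s` changes the coefficient of `x ^ (N + 2)` in `s' Y - X` by `c *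
    -- ((N + 2) * l₂ - l₁)`, and this must cancel `E.coeff 0`.
    set c : ℂ := -E.coeff 0 / (((N + 2 : ℕ) : ℂ) * l₂ - l₁) with hc
    set u : Polynomial ℂ := Polynomial.C c * Polynomial.X ^ (N + 2) with hu
    obtain ⟨a, ha⟩ : Polynomial.X ∣ Polynomial.derivative s := by
      rw [Polynomial.X_dvd_iff, Polynomial.coeff_derivative]
      simp [hs1]
    obtain ⟨b, hb⟩ : Polynomial.X ∣ branch i s Y := by
      rw [Polynomial.X_dvd_iff, coeff_zero_branch hs0, hY]
    have hb0 : b.coeff 0 = l₂ := by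
      have h := coeff_one_branch hij hs0 hs1 Y
      rw [hb, hYj] at h
      simpa using h
    obtain ⟨rX, hrX⟩ := exists_aeval_update_add X (fun _ => Polynomial.X) i s u
    obtain ⟨rY, hrY⟩ := exists_aeval_update_add Y (fun _ => Polynomial.X) i s u
    change branch i (s + u) X = branch i s X + u * branch i s (MvPolynomial.pderiv i X)
      + u ^ 2 * rX at hrX
    change branch i (s + u) Y = branch i s Y + u * branch i s (MvPolynomial.pderiv i Y)
      + u ^ 2 * rY at hrY
    have hdu : Polynomial.derivative u
        = Polynomial.C c * Polynomial.C ((N + 2 : ℕ) : ℂ) * Polynomial.X ^ (N + 1) := by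
      rw [hu, Polynomial.derivative_C_mul, Polynomial.derivative_X_pow]
      simp only [show N + 2 - 1 = N + 1 by omega]
      ring
    refine ⟨s + u, by simp [hs0, hu, Polynomial.coeff_X_pow],
      by simp [hs1, hu, Polynomial.coeff_X_pow], ?_⟩
    obtain ⟨e, he⟩ : Polynomial.X ∣ E + Polynomial.C c * Polynomial.C ((N + 2 : ℕ) : ℂ) * b
        - Polynomial.C c * branch i s (MvPolynomial.pderiv i X) := by
      rw [Polynomial.X_dvd_iff]
      simp only [Polynomial.coeff_add, Polynomial.coeff_sub, Polynomial.mul_coeff_zero,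
        Polynomial.coeff_C_zero, hb0, coeff_zero_branch hs0, hXi]
      rw [hc]
      field_simp
      ring
    set gX := branch i s (MvPolynomial.pderiv i X)
    set gY := branch i s (MvPolynomial.pderiv i Y)
    refine ⟨e + a * (Polynomial.C c * gY + Polynomial.C c * u * rY)
      + Polynomial.C c * Polynomial.C ((N + 2 : ℕ) : ℂ) * Polynomial.X ^ N *
        (Polynomial.C c * gY + Polynomial.C c * u * rY)
      - Polynomial.C c ^ 2 * Polynomial.X ^ (N + 1) * rX, ?_⟩
    rw [Polynomial.derivative_add, hrX, hrY, hdu, ha, hb]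
    rw [ha, hb] at hE
    have hX2 : (Polynomial.X : Polynomial ℂ) ^ (N + 2) = Polynomial.X ^ N * Polynomial.X ^ 2 := by
      ring
    rw [show N + 1 + 2 = N + 3 by omega]
    rw [hu]
    linear_combination hE + Polynomial.X ^ (N + 2) * he

/-! ### Local structure of a reduced invariant curve -/

theorem pderiv_comm {σ : Type*} (i j : σ) (p : MvPolynomial σ ℂ) :
    MvPolynomial.pderiv i (MvPolynomial.pderiv j p) =
      MvPolynomial.pderiv j (MvPolynomial.pderiv i p) := by
  classical
  have h : ⁅MvPolynomial.pderiv (R := ℂ) i, MvPolynomial.pderiv (R := ℂ) j⁆ = 0 := by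
    apply MvPolynomial.derivation_ext
    intro l
    simp only [Derivation.commutator_apply, MvPolynomial.pderiv_X, Pi.single_apply]
    split_ifs <;> simp
  have h1 := DFunLike.congr_fun h p
  rw [Derivation.commutator_apply] at h1
  exact sub_eq_zero.1 h1

/-- Derivative of the invariance relation. -/
theorem field_pderiv_eq {X Y k h : MvPolynomial (Fin 2) ℂ} {i j : Fin 2}
    (hinv : X * MvPolynomial.pderiv i h + Y * MvPolynomial.pderiv j h = k * h) (l : Fin 2) :
    X * MvPolynomial.pderiv i (MvPolynomial.pderiv l h)
        + Y * MvPolynomial.pderiv j (MvPolynomial.pderiv l h) =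
      MvPolynomial.pderiv l k * h + k * MvPolynomial.pderiv l h
        - MvPolynomial.pderiv l X * MvPolynomial.pderiv i h
        - MvPolynomial.pderiv l Y * MvPolynomial.pderiv j h := by
  have h1 := congrArg (MvPolynomial.pderiv l) hinv
  simp only [map_add, Derivation.leibniz, smul_eq_mul] at h1
  rw [pderiv_comm i l, pderiv_comm j l]
  linear_combination h1

/-- The singular points of an invariant reduced curve are singular points of the vector field. -/
theorem exists_eval_ne_zero_of_field_ne_zero {i j : Fin 2} {X Y k h : MvPolynomial (Fin 2) ℂ}
    (hij : i ≠ j)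
    (hinv : X * MvPolynomial.pderiv i h + Y * MvPolynomial.pderiv j h = k * h)
    (hX : MvPolynomial.eval 0 X ≠ 0) {δ : Polynomial ℂ} (hδ : δ ≠ 0)
    {a b : MvPolynomial (Fin 2) ℂ}
    (hab : Polynomial.aeval (MvPolynomial.X i) δ = a * h + b * MvPolynomial.pderiv j h)
    (h0 : MvPolynomial.eval 0 h = 0) (hi : MvPolynomial.eval 0 (MvPolynomial.pderiv i h) = 0)
    (hj : MvPolynomial.eval 0 (MvPolynomial.pderiv j h) = 0) : False := by
  -- The ideal generated by `h` and its partial derivatives is stable under the field. Applying the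
  -- field to `x_i ^ (M + 1) * g` lowers the power of `x_i` by one and multiplies the value of the
  -- cofactor `g` at the origin by `(M + 1) * X(0) ≠ 0`. At power zero an element of the ideal would
  -- be nonzero at the origin, where the whole ideal vanishes.
  have key : ∀ (M : ℕ) (g a b c : MvPolynomial (Fin 2) ℂ), MvPolynomial.eval 0 g ≠ 0 →
      MvPolynomial.X i ^ M * g
        = a * h + b * MvPolynomial.pderiv i h + c * MvPolynomial.pderiv j h → False := by
    intro M
    induction M with
    | zero =>
      intro g a b c hg hgc
      have h1 := congrArg (MvPolynomial.eval 0) hgc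
      simp only [map_mul, map_add, h0, hi, hj, mul_zero, add_zero, pow_zero, one_mul] at h1
      exact hg h1
    | succ M ih =>
      intro g a b c hg hgc
      have d1 := congrArg (MvPolynomial.pderiv i) hgc
      have d2 := congrArg (MvPolynomial.pderiv j) hgc
      simp only [map_add, Derivation.leibniz, smul_eq_mul, MvPolynomial.pderiv_X_self,
        MvPolynomial.pderiv_X_of_ne hij, Derivation.leibniz_pow, Nat.add_sub_cancel, mul_one,
        nsmul_eq_mul, mul_zero, add_zero] at d1 d2
      have e1 := field_pderiv_eq hinv i
      have e2 := field_pderiv_eq hinv j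
      refine ih (((M + 1 : ℕ) : MvPolynomial (Fin 2) ℂ) * X * g + MvPolynomial.X i *
          (X * MvPolynomial.pderiv i g + Y * MvPolynomial.pderiv j g))
        (X * MvPolynomial.pderiv i a + Y * MvPolynomial.pderiv j a + a * k
          + b * MvPolynomial.pderiv i k + c * MvPolynomial.pderiv j k)
        (X * MvPolynomial.pderiv i b + Y * MvPolynomial.pderiv j b + b * k
          - b * MvPolynomial.pderiv i X - c * MvPolynomial.pderiv j X)
        (X * MvPolynomial.pderiv i c + Y * MvPolynomial.pderiv j c + c * k
          - b * MvPolynomial.pderiv i Y - c * MvPolynomial.pderiv j Y) ?_ ?_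
      · simp only [map_add, map_mul, MvPolynomial.eval_X, Pi.zero_apply, zero_mul, add_zero,
          map_natCast]
        exact mul_ne_zero (mul_ne_zero (by exact_mod_cast M.succ_ne_zero) hX) hg
      · linear_combination X * d1 + Y * d2 + a * hinv + b * e1 + c * e2
  -- Write `δ = x ^ M * q` with `q(0) ≠ 0`; the descent starts from this `M`.
  obtain ⟨q, hq, hq0⟩ := Polynomial.exists_eq_pow_rootMultiplicity_mul_and_not_dvd δ hδ 0
  rw [map_zero, sub_zero] at hq hq0
  refine key (δ.rootMultiplicity 0) (Polynomial.aeval (MvPolynomial.X i) q) a 0 b ?_ ?_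
  · intro h1
    apply hq0
    rw [Polynomial.X_dvd_iff, Polynomial.coeff_zero_eq_eval_zero]
    have h2 : (MvPolynomial.aeval (0 : Fin 2 → ℂ)).comp (Polynomial.aeval (MvPolynomial.X (R := ℂ) i))
        = Polynomial.aeval (0 : ℂ) := by
      apply Polynomial.algHom_ext
      simp
    have h3 := DFunLike.congr_fun h2 q
    rw [AlgHom.comp_apply, MvPolynomial.aeval_eq_eval] at h3
    rw [← Polynomial.coe_aeval_eq_eval, ← h3]
    exact h1
  · have h1 := congrArg (Polynomial.aeval (MvPolynomial.X i : MvPolynomial (Fin 2) ℂ)) hq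
    simp only [map_mul, map_pow, Polynomial.aeval_X] at h1
    rw [← h1, hab]
    ring

/-- The possible weights of a reduced curve through a nonresonant singular point, read off from
the separatrix tangent to the `j`-th axis. -/
theorem weight_of_separatrix {i j : Fin 2} (hij : i ≠ j) {X Y k h : MvPolynomial (Fin 2) ℂ}
    {l₁ l₂ : ℂ} (hX : MvPolynomial.eval 0 X = 0) (hY : MvPolynomial.eval 0 Y = 0)
    (hXi : MvPolynomial.eval 0 (MvPolynomial.pderiv i X) = l₁)
    (hXj : MvPolynomial.eval 0 (MvPolynomial.pderiv j X) = 0)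
    (hYj : MvPolynomial.eval 0 (MvPolynomial.pderiv j Y) = l₂)
    (hres : ∀ n : ℕ, (n : ℂ) * l₂ ≠ l₁)
    (hinv : X * MvPolynomial.pderiv i h + Y * MvPolynomial.pderiv j h = k * h)
    {δ : Polynomial ℂ} (hδ : δ ≠ 0) {a b : MvPolynomial (Fin 2) ℂ}
    (hab : Polynomial.aeval (MvPolynomial.X j) δ = a * h + b * MvPolynomial.pderiv i h)
    (h0 : MvPolynomial.eval 0 h = 0) (hi : MvPolynomial.eval 0 (MvPolynomial.pderiv i h) = 0)
    (hj : MvPolynomial.eval 0 (MvPolynomial.pderiv j h) = 0) :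
    (∃ n : ℕ, 2 ≤ n ∧ MvPolynomial.eval 0 k = n * l₂) ∨
    (∃ n : ℕ, 1 ≤ n ∧ MvPolynomial.eval 0 k = l₁ + n * l₂ ∧
      (n = 1 → MvPolynomial.eval 0 (MvPolynomial.pderiv j (MvPolynomial.pderiv i h)) ≠ 0)) := by
  by_contra hcon
  push Not at hcon
  obtain ⟨hc1, hc2⟩ := hcon
  -- If both alternatives fail, `h` and `∂_i h` vanish to every order along the approximate
  -- separatrices, and so does `δ`, which depends only on their parameter.
  have key : ∀ N : ℕ, Polynomial.X ^ N ∣ δ := by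
    intro N
    obtain ⟨s, hs0, hs1, E, hE⟩ := exists_approximate_separatrix hij X Y hX hY hXi hXj hYj hres
      (N + 1)
    have hY0 : (branch i s Y).coeff 0 = 0 := by rw [coeff_zero_branch hs0, hY]
    have hY1 : (branch i s Y).coeff 1 = l₂ := by rw [coeff_one_branch hij hs0 hs1, hYj]
    have hs0' : (Polynomial.derivative s).coeff 0 = 0 := by
      simp [Polynomial.coeff_derivative, hs1]
    -- Along the branch `Y g' = k g` up to order `N + 1`, so a first nonzero coefficient of order
    -- `e` requires `k(0) = e * l₂`; orders 0 and 1 are excluded because `h` and its gradient vanish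
    -- at the origin.
    have hd : Polynomial.X ^ (N + 1) ∣ branch i s h := by
      refine X_pow_dvd_of_singular_ode hY0 (B := branch i s k) ?_ ?_
      · refine ⟨E * branch i s (MvPolynomial.pderiv i h), ?_⟩
        have e := congrArg (branch i s) hinv
        simp only [map_add, map_mul] at e
        rw [derivative_branch hij]
        linear_combination branch i s (MvPolynomial.pderiv i h) * hE + e
      · intro e he
        rw [coeff_zero_branch hs0, hY1] at he
        rcases e with _ | _ | e
        · rw [coeff_zero_branch hs0, h0]
        · rw [zero_add, coeff_one_branch hij hs0 hs1, hj]
        · exact absurd he (hc1 _ (by omega))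
    obtain ⟨r, hr⟩ := hd
    have hdh := derivative_branch hij s h
    have hder : Polynomial.derivative (branch i s h) =
        Polynomial.X ^ N * (Polynomial.C ((N + 1 : ℕ) : ℂ) * r
          + Polynomial.X * Polynomial.derivative r) := by
      rw [hr, Polynomial.derivative_mul, Polynomial.derivative_X_pow]
      simp only [Nat.add_sub_cancel]
      ring
    -- Once `h` is negligible, `∂_j h = -s' ∂_i h` up to order `N`, one order being lost by
    -- differentiation. The differentiated invariance relation thus becomes an equation of the same
    -- type for `∂_i h`, whose weight at the origin is `k(0) - l₁`.
    have hd1 : Polynomial.X ^ N ∣ branch i s (MvPolynomial.pderiv i h) := by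
      refine X_pow_dvd_of_singular_ode hY0 (B := branch i s k - branch i s (MvPolynomial.pderiv i X)
        + Polynomial.derivative s * branch i s (MvPolynomial.pderiv i Y)) ?_ ?_
      · refine ⟨E * Polynomial.X * branch i s (MvPolynomial.pderiv i (MvPolynomial.pderiv i h))
          + branch i s (MvPolynomial.pderiv i k) * Polynomial.X * r
          - branch i s (MvPolynomial.pderiv i Y) * (Polynomial.C ((N + 1 : ℕ) : ℂ) * r
          + Polynomial.X * Polynomial.derivative r), ?_⟩
        have e := congrArg (branch i s) (field_pderiv_eq hinv i)
        simp only [map_add, map_mul, map_sub] at e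
        rw [derivative_branch hij]
        rw [hdh] at hder
        linear_combination branch i s (MvPolynomial.pderiv i (MvPolynomial.pderiv i h)) * hE + e
          + branch i s (MvPolynomial.pderiv i k) * hr
          - branch i s (MvPolynomial.pderiv i Y) * hder
      · intro e he
        simp only [Polynomial.coeff_add, Polynomial.coeff_sub, Polynomial.mul_coeff_zero, hs0',
          coeff_zero_branch hs0, hXi, hY1, zero_mul, add_zero] at he
        rcases e with _ | _ | e
        · rw [coeff_zero_branch hs0, hi]
        · rw [zero_add, coeff_one_branch hij hs0 hs1]
          refine (hc2 1 le_rfl ?_).2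
          rw [zero_add] at he
          linear_combination he
        · have := hc2 (e + 2) (by omega) (by linear_combination he)
          omega
    have e := congrArg (branch i s) hab
    have hδ' : branch i s (Polynomial.aeval (MvPolynomial.X j) δ) = δ := by
      have h2 : (branch i s).comp (Polynomial.aeval (MvPolynomial.X j))
          = AlgHom.id ℂ (Polynomial ℂ) := by
        apply Polynomial.algHom_ext
        simp [branch, Function.update_of_ne hij.symm]
      exact DFunLike.congr_fun h2 δ
    rw [hδ'] at e
    rw [e, map_add, map_mul, map_mul]
    refine dvd_add (Dvd.dvd.mul_left ?_ _) (Dvd.dvd.mul_left hd1 _)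
    exact (pow_dvd_pow _ N.le_succ).trans ⟨r, hr⟩
  apply hδ
  ext d
  rw [Polynomial.X_pow_dvd_iff.1 (key (d + 1)) d d.lt_succ_self, Polynomial.coeff_zero]

/-- At a hyperbolic singular point the equation of a reduced invariant curve with a singularity
there has a quadratic part that is a nonzero multiple of the product of the eigencoordinates. -/
theorem hessian_of_hyperbolic {X Y k h : MvPolynomial (Fin 2) ℂ}
    {l₁ l₂ : ℂ} (hX : MvPolynomial.eval 0 X = 0) (hY : MvPolynomial.eval 0 Y = 0)
    (hX0 : MvPolynomial.eval 0 (MvPolynomial.pderiv 0 X) = l₁)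
    (hX1 : MvPolynomial.eval 0 (MvPolynomial.pderiv 1 X) = 0)
    (hY0 : MvPolynomial.eval 0 (MvPolynomial.pderiv 0 Y) = 0)
    (hY1 : MvPolynomial.eval 0 (MvPolynomial.pderiv 1 Y) = l₂)
    (him : (l₁ / l₂).im ≠ 0)
    (hinv : X * MvPolynomial.pderiv 0 h + Y * MvPolynomial.pderiv 1 h = k * h)
    {δ₀ δ₁ : Polynomial ℂ} (hδ₀ : δ₀ ≠ 0) (hδ₁ : δ₁ ≠ 0) {a₀ b₀ a₁ b₁ : MvPolynomial (Fin 2) ℂ}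
    (hab₀ : Polynomial.aeval (MvPolynomial.X 0) δ₀ = a₀ * h + b₀ * MvPolynomial.pderiv 1 h)
    (hab₁ : Polynomial.aeval (MvPolynomial.X 1) δ₁ = a₁ * h + b₁ * MvPolynomial.pderiv 0 h)
    (h0 : MvPolynomial.eval 0 h = 0) (hh0 : MvPolynomial.eval 0 (MvPolynomial.pderiv 0 h) = 0)
    (hh1 : MvPolynomial.eval 0 (MvPolynomial.pderiv 1 h) = 0) :
    MvPolynomial.eval 0 (MvPolynomial.pderiv 0 (MvPolynomial.pderiv 0 h)) = 0 ∧
    MvPolynomial.eval 0 (MvPolynomial.pderiv 1 (MvPolynomial.pderiv 1 h)) = 0 ∧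
    MvPolynomial.eval 0 (MvPolynomial.pderiv 1 (MvPolynomial.pderiv 0 h)) ≠ 0 := by
  have hl₂ : l₂ ≠ 0 := by
    rintro rfl
    simp at him
  have hind : ∀ x y : ℝ, (x : ℂ) * l₁ = y * l₂ → x = 0 ∧ y = 0 := by
    intro x y hxy
    have h1 : (x : ℂ) * (l₁ / l₂) = y := by
      rw [mul_div_assoc', hxy, mul_div_assoc, div_self hl₂, mul_one]
    have h2 := congrArg Complex.im h1
    rw [Complex.im_ofReal_mul, Complex.ofReal_im] at h2
    have hx : x = 0 := (mul_eq_zero.1 h2).resolve_right him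
    rw [hx, Complex.ofReal_zero, zero_mul] at h1
    exact ⟨hx, (Complex.ofReal_eq_zero.1 h1.symm)⟩
  have r1 : ∀ n : ℕ, (n : ℂ) * l₂ ≠ l₁ := by
    intro n hn
    have := hind 1 n (by push_cast; linear_combination -hn)
    norm_num at this
  have r2 : ∀ n : ℕ, (n : ℂ) * l₁ ≠ l₂ := by
    intro n hn
    have := hind n 1 (by push_cast; linear_combination hn)
    norm_num at this
  have w1 := weight_of_separatrix (i := 0) (j := 1) (by decide) hX hY hX0 hX1 hY1 r1 hinv hδ₁ hab₁
    h0 hh0 hh1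
  have w2 := weight_of_separatrix (i := 1) (j := 0) (by decide) hY hX hY1 hY0 hX0 r2
    (k := k) (by linear_combination hinv) hδ₀ hab₀ h0 hh1 hh0
  -- Each separatrix allows two forms for `k(0)`. Independence of `l₁` and `l₂` over the reals rules
  -- out every pairing except `l₁ + n l₂ = l₂ + m l₁` with `n = m = 1`.
  have hκ : MvPolynomial.eval 0 k = l₁ + l₂ ∧
      MvPolynomial.eval 0 (MvPolynomial.pderiv 1 (MvPolynomial.pderiv 0 h)) ≠ 0 := by
    rcases w1 with ⟨n, hn, e⟩ | ⟨n, hn, e, hne⟩ <;> rcases w2 with ⟨m, hm, e'⟩ | ⟨m, hm, e', -⟩ <;>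
      rw [e] at e'
    · have := (hind m n (by push_cast; linear_combination -e')).1
      norm_num at this
      omega
    · have := (hind m (n - 1) (by push_cast; linear_combination -e')).1
      norm_num at this
      omega
    · have := (hind (m - 1) n (by push_cast; linear_combination -e')).2
      norm_num at this
      omega
    · have := (hind (m - 1) (n - 1) (by push_cast; linear_combination -e')).2
      have hn1 : n = 1 := by
        have : (n : ℝ) = 1 := by linarith
        exact_mod_cast this
      subst hn1
      exact ⟨by rw [e]; push_cast; ring, hne rfl⟩
  refine ⟨?_, ?_, hκ.2⟩
  -- The second derivative of the invariance relation at the origin reads `2 l₁ h₀₀ = (l₁ + l₂)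
  -- h₀₀`, and `l₁ ≠ l₂`.
  · have e := congrArg (MvPolynomial.eval 0)
      (congrArg (MvPolynomial.pderiv 0) (field_pderiv_eq hinv 0))
    simp only [map_add, map_sub, map_mul, Derivation.leibniz, smul_eq_mul, hX, hY, hX0, hY0, h0,
      hh0, hh1, hκ.1] at e
    have e2 : (l₁ - l₂) *
        MvPolynomial.eval 0 (MvPolynomial.pderiv 0 (MvPolynomial.pderiv 0 h)) = 0 := by
      linear_combination e
    refine (mul_eq_zero.1 e2).resolve_left fun h1 => r1 1 ?_
    push_cast
    linear_combination -h1
  · have e := congrArg (MvPolynomial.eval 0)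
      (congrArg (MvPolynomial.pderiv 1) (field_pderiv_eq hinv 1))
    simp only [map_add, map_sub, map_mul, Derivation.leibniz, smul_eq_mul, hX, hY, hX1, hY1, h0,
      hh0, hh1, hκ.1] at e
    have e2 : (l₂ - l₁) *
        MvPolynomial.eval 0 (MvPolynomial.pderiv 1 (MvPolynomial.pderiv 1 h)) = 0 := by
      linear_combination e
    refine (mul_eq_zero.1 e2).resolve_left fun h1 => r1 1 ?_
    push_cast
    linear_combination h1

/-! ### Linear coordinates, homogeneity and discriminants -/

/-- Substitution of the linear change of coordinates `z ↦ z ᵥ* M`. -/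
noncomputable def linSubst (M : Matrix (Fin 3) (Fin 3) ℂ) :
    MvPolynomial (Fin 3) ℂ →ₐ[ℂ] MvPolynomial (Fin 3) ℂ :=
  MvPolynomial.aeval fun i => ∑ j, MvPolynomial.C (M j i) * MvPolynomial.X j

theorem linSubst_linSubst (M N : Matrix (Fin 3) (Fin 3) ℂ) (p : MvPolynomial (Fin 3) ℂ) :
    linSubst M (linSubst N p) = linSubst (M * N) p := by
  have h : (linSubst M).comp (linSubst N) = linSubst (M * N) := by
    apply MvPolynomial.algHom_ext
    intro i
    simp only [linSubst, AlgHom.comp_apply, MvPolynomial.aeval_X, map_sum, map_mul,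
      MvPolynomial.algHom_C, Matrix.mul_apply, Finset.mul_sum, Finset.sum_mul,
      MvPolynomial.algebraMap_eq]
    rw [Finset.sum_comm]
    refine Finset.sum_congr rfl fun j _ => Finset.sum_congr rfl fun k _ => ?_
    ring
  exact DFunLike.congr_fun h p

theorem linSubst_one (p : MvPolynomial (Fin 3) ℂ) : linSubst 1 p = p := by
  have h : linSubst 1 = AlgHom.id ℂ (MvPolynomial (Fin 3) ℂ) := by
    apply MvPolynomial.algHom_ext
    intro i
    simp [linSubst, Matrix.one_apply]
  exact DFunLike.congr_fun h p

/-- An invertible linear change of coordinates, as an automorphism of the polynomial ring. -/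
noncomputable def linSubstEquiv (M : Matrix (Fin 3) (Fin 3) ℂ) (hM : IsUnit M.det) :
    MvPolynomial (Fin 3) ℂ ≃ₐ[ℂ] MvPolynomial (Fin 3) ℂ :=
  AlgEquiv.ofAlgHom (linSubst M) (linSubst M⁻¹)
    (by ext1 i; simp only [AlgHom.comp_apply, linSubst_linSubst, Matrix.mul_nonsing_inv M hM,
          linSubst_one, AlgHom.id_apply])
    (by ext1 i; simp only [AlgHom.comp_apply, linSubst_linSubst, Matrix.nonsing_inv_mul M hM,
          linSubst_one, AlgHom.id_apply])

theorem linSubstEquiv_apply (M : Matrix (Fin 3) (Fin 3) ℂ) (hM : IsUnit M.det)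
    (p : MvPolynomial (Fin 3) ℂ) : linSubstEquiv M hM p = linSubst M p := rfl

theorem pderiv_linSubst (M : Matrix (Fin 3) (Fin 3) ℂ) (j : Fin 3) (p : MvPolynomial (Fin 3) ℂ) :
    MvPolynomial.pderiv j (linSubst M p) =
      linSubst M (∑ i, MvPolynomial.C (M j i) * MvPolynomial.pderiv i p) := by
  rw [linSubst, derivation_aeval, map_sum]
  refine Finset.sum_congr rfl fun i _ => ?_
  simp [MvPolynomial.pderiv_X, Pi.single_apply, mul_comm, MvPolynomial.algebraMap_eq]

theorem eval_linSubst (M : Matrix (Fin 3) (Fin 3) ℂ) (z : Fin 3 → ℂ) (p : MvPolynomial (Fin 3) ℂ) :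
    MvPolynomial.eval z (linSubst M p) = MvPolynomial.eval (Matrix.vecMul z M) p := by
  have h : (MvPolynomial.aeval z).comp (linSubst M) = MvPolynomial.aeval (Matrix.vecMul z M) := by
    apply MvPolynomial.algHom_ext
    intro i
    simp [linSubst, Matrix.vecMul, dotProduct, mul_comm]
  have h1 := DFunLike.congr_fun h p
  rwa [AlgHom.comp_apply, MvPolynomial.aeval_eq_eval, MvPolynomial.aeval_eq_eval] at h1

theorem squarefree_mulEquiv {A B : Type*} [CommRing A] [CommRing B] [Algebra ℂ A] [Algebra ℂ B]
    (e : A ≃ₐ[ℂ] B) {a : A} (ha : Squarefree a) : Squarefree (e a) := by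
  intro x hx
  have h : e.symm x * e.symm x ∣ a := by
    rw [← map_mul]
    simpa using map_dvd e.symm hx
  simpa using (ha _ h).map e

theorem finSuccEquiv_rename_succ (r : MvPolynomial (Fin 2) ℂ) :
    MvPolynomial.finSuccEquiv ℂ 2 (MvPolynomial.rename Fin.succ r) = Polynomial.C r := by
  induction r using MvPolynomial.induction_on with
  | C a => simp [MvPolynomial.finSuccEquiv_apply]
  | add p q hp hq => simp only [map_add, hp, hq]
  | mul_X p j hp =>
    rw [map_mul, map_mul, hp, MvPolynomial.rename_X, MvPolynomial.finSuccEquiv_X_succ, map_mul]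

theorem derivative_finSuccEquiv (p : MvPolynomial (Fin 3) ℂ) :
    Polynomial.derivative (MvPolynomial.finSuccEquiv ℂ 2 p) =
      MvPolynomial.finSuccEquiv ℂ 2 (MvPolynomial.pderiv 0 p) := by
  induction p using MvPolynomial.induction_on with
  | C a => simp [MvPolynomial.finSuccEquiv_apply]
  | add p q hp hq => simp only [map_add, hp, hq]
  | mul_X p j hp =>
    rw [map_mul, Polynomial.derivative_mul, hp, Derivation.leibniz]
    refine Fin.cases ?_ (fun j => ?_) j
    · simp [MvPolynomial.finSuccEquiv_X_zero]
      ring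
    · rw [MvPolynomial.pderiv_X_of_ne (Fin.succ_ne_zero j)]
      simp [MvPolynomial.finSuccEquiv_X_succ]
      ring

theorem aeval_smul_of_isHomogeneous {σ B : Type*} [Fintype σ] [CommRing B] [Algebra ℂ B]
    {p : MvPolynomial σ ℂ} {n : ℕ} (hp : p.IsHomogeneous n) (c : B) (g : σ → B) :
    MvPolynomial.aeval (fun i => c * g i) p = c ^ n * MvPolynomial.aeval g p := by
  rw [MvPolynomial.aeval_def, MvPolynomial.aeval_def, MvPolynomial.eval₂_eq',
    MvPolynomial.eval₂_eq', Finset.mul_sum]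
  refine Finset.sum_congr rfl fun d hd => ?_
  have hn : n = ∑ i, d i := by
    rw [hp.degree_eq_sum_deg_support hd]
    exact Finset.sum_subset (Finset.subset_univ _) fun i _ hi => by simpa using hi
  simp only [mul_pow, Finset.prod_mul_distrib, Finset.prod_pow_eq_pow_sum, ← hn]
  ring

theorem eval_smul_of_isHomogeneous {σ : Type*} [Fintype σ]
    {p : MvPolynomial σ ℂ} {n : ℕ} (hp : p.IsHomogeneous n) (c : ℂ) (v : σ → ℂ) :
    MvPolynomial.eval (c • v) p = c ^ n * MvPolynomial.eval v p := by
  have h := aeval_smul_of_isHomogeneous hp c v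
  rw [MvPolynomial.aeval_eq_eval, MvPolynomial.aeval_eq_eval] at h
  exact h

/-- Elimination of the first coordinate between a reduced equation and its derivative. -/
theorem exists_discriminant {H : MvPolynomial (Fin 3) ℂ} (hH : Squarefree H)
    (M : Matrix (Fin 3) (Fin 3) ℂ) (hM : IsUnit M.det) :
    ∃ r : MvPolynomial (Fin 2) ℂ, r ≠ 0 ∧ ∃ a b : MvPolynomial (Fin 3) ℂ,
      a * linSubst M H + b * linSubst M (∑ i, MvPolynomial.C (M 0 i) * MvPolynomial.pderiv i H)
        = MvPolynomial.rename Fin.succ r := by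
  set e := MvPolynomial.finSuccEquiv ℂ 2
  have hsq : Squarefree (e (linSubst M H)) :=
    squarefree_mulEquiv e (squarefree_mulEquiv (linSubstEquiv M hM) hH)
  obtain ⟨r, hr, a, b, hab⟩ := exists_combination_eq_C (e (linSubst M H))
    (e (linSubst M (∑ i, MvPolynomial.C (M 0 i) * MvPolynomial.pderiv i H))) hsq.ne_zero
    (fun f hf hdeg hfp => by
      rw [← pderiv_linSubst, ← derivative_finSuccEquiv]
      exact not_dvd_derivative_of_squarefree hsq hf hdeg hfp)
  refine ⟨r, hr, e.symm a, e.symm b, ?_⟩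
  apply e.injective
  rw [map_add, map_mul, map_mul, e.apply_symm_apply, e.apply_symm_apply, hab,
    finSuccEquiv_rename_succ]

/-! ### Affine charts adapted to a frame -/

/-- The affine parametrization of a chart around `[v]`, with two given directions. -/
noncomputable def slice (v e₁ e₂ : Fin 3 → ℂ) : Fin 3 → MvPolynomial (Fin 2) ℂ :=
  fun l => MvPolynomial.C (v l) + MvPolynomial.X 0 * MvPolynomial.C (e₁ l)
    + MvPolynomial.X 1 * MvPolynomial.C (e₂ l)

/-- Elimination, in a chart, of one coordinate between a reduced equation and its derivative. -/
theorem exists_slice_discriminant {H : MvPolynomial (Fin 3) ℂ} {n : ℕ} (hH : Squarefree H)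
    (hn : H.IsHomogeneous n) (v e e' : Fin 3 → ℂ) (hM : IsUnit (Matrix.of ![e, v, e']).det)
    {i j : Fin 2} {α : Fin 3 → MvPolynomial (Fin 2) ℂ}
    (hα : ∀ l, α l = MvPolynomial.C (v l) + MvPolynomial.X i * MvPolynomial.C (e l)
      + MvPolynomial.X j * MvPolynomial.C (e' l)) :
    ∃ δ : Polynomial ℂ, δ ≠ 0 ∧ ∃ a b : MvPolynomial (Fin 2) ℂ,
      Polynomial.aeval (MvPolynomial.X j) δ = a * MvPolynomial.aeval α H
        + b * MvPolynomial.aeval α (∑ l, MvPolynomial.C (e l) * MvPolynomial.pderiv l H) := by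
  obtain ⟨r, hr, a, b, hab⟩ := exists_discriminant hH _ hM
  -- The eliminant `r` need not be homogeneous, so setting its first variable to 1 might kill it. It
  -- is set instead to `c = p 0`, where `r(p) ≠ 0` and `c ≠ 0`.
  obtain ⟨p, hp⟩ : ∃ p : Fin 2 → ℂ, MvPolynomial.eval p (MvPolynomial.X 0 * r) ≠ 0 := by
    by_contra hcon
    push Not at hcon
    exact mul_ne_zero (MvPolynomial.X_ne_zero (R := ℂ) (0 : Fin 2)) hr
      (MvPolynomial.funext fun x => by rw [hcon x, map_zero])
  rw [map_mul, MvPolynomial.eval_X] at hp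
  have hc : p 0 ≠ 0 := left_ne_zero_of_mul hp
  have hrp := right_ne_zero_of_mul hp
  set c := p 0
  refine ⟨MvPolynomial.aeval ![Polynomial.C c, Polynomial.C c * Polynomial.X] r, ?_, ?_⟩
  · intro h0
    apply hrp
    have h1 : (Polynomial.aeval (p 1 / c)).comp
        (MvPolynomial.aeval ![Polynomial.C c, Polynomial.C c * Polynomial.X])
        = MvPolynomial.aeval p := by
      apply MvPolynomial.algHom_ext
      intro l
      fin_cases l
      · simp [c]
      · simp
        field_simp
    have h2 := DFunLike.congr_fun h1 r
    rw [AlgHom.comp_apply, h0, map_zero, MvPolynomial.aeval_eq_eval] at h2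
    exact h2.symm
  -- In the frame `e, v, e'` this substitutes `c` times the chart point; homogeneity turns the
  -- scaling into powers of `c`.
  · set ψ : MvPolynomial (Fin 3) ℂ →ₐ[ℂ] MvPolynomial (Fin 2) ℂ :=
      MvPolynomial.aeval ![MvPolynomial.C c * MvPolynomial.X i, MvPolynomial.C c,
        MvPolynomial.C c * MvPolynomial.X j] with hψ
    have hcomp : ∀ q : MvPolynomial (Fin 3) ℂ, ∀ m, q.IsHomogeneous m →
        ψ (linSubst (Matrix.of ![e, v, e']) q) = MvPolynomial.C c ^ m * MvPolynomial.aeval α q := by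
      intro q m hq
      rw [← aeval_smul_of_isHomogeneous hq]
      have h1 : ψ.comp (linSubst (Matrix.of ![e, v, e']))
          = MvPolynomial.aeval fun l => MvPolynomial.C c * α l := by
        apply MvPolynomial.algHom_ext
        intro l
        simp only [linSubst, hψ, AlgHom.comp_apply, MvPolynomial.aeval_X, Fin.sum_univ_three,
          map_add, map_mul, MvPolynomial.algHom_C, MvPolynomial.algebraMap_eq, hα]
        simp
        ring
      exact DFunLike.congr_fun h1 q
    have hren : ψ (MvPolynomial.rename Fin.succ r) =
        Polynomial.aeval (MvPolynomial.X j)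
          (MvPolynomial.aeval ![Polynomial.C c, Polynomial.C c * Polynomial.X] r) := by
      have h1 : ψ.comp (MvPolynomial.rename Fin.succ) =
          (Polynomial.aeval (MvPolynomial.X (R := ℂ) j)).comp
          (MvPolynomial.aeval ![Polynomial.C c, Polynomial.C c * Polynomial.X]) := by
        apply MvPolynomial.algHom_ext
        intro l
        fin_cases l <;> simp [hψ, MvPolynomial.algebraMap_eq]
      exact DFunLike.congr_fun h1 r
    have hD : (∑ l, MvPolynomial.C (e l) * MvPolynomial.pderiv l H).IsHomogeneous (n - 1) :=
      MvPolynomial.IsHomogeneous.sum _ _ _ fun l _ => hn.pderiv.C_mul _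
    have h2 := congrArg ψ hab
    rw [hren, map_add, map_mul, map_mul, hcomp H n hn] at h2
    have h3 := hcomp _ _ hD
    refine ⟨ψ a * MvPolynomial.C c ^ n, ψ b * MvPolynomial.C c ^ (n - 1), ?_⟩
    rw [← h2, mul_assoc, mul_assoc, ← h3]
    rfl

theorem pderiv_aeval_slice (v e₁ e₂ : Fin 3 → ℂ) (p : MvPolynomial (Fin 3) ℂ) :
    MvPolynomial.pderiv 0 (MvPolynomial.aeval (slice v e₁ e₂) p) =
      MvPolynomial.aeval (slice v e₁ e₂) (∑ l, MvPolynomial.C (e₁ l) * MvPolynomial.pderiv l p) ∧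
    MvPolynomial.pderiv 1 (MvPolynomial.aeval (slice v e₁ e₂) p) =
      MvPolynomial.aeval (slice v e₁ e₂) (∑ l, MvPolynomial.C (e₂ l) * MvPolynomial.pderiv l p) := by
  constructor <;>
  · rw [derivation_aeval, map_sum]
    refine Finset.sum_congr rfl fun i _ => ?_
    simp [slice, MvPolynomial.pderiv_X, MvPolynomial.algebraMap_eq, mul_comm]

theorem eval_aeval_slice (v e₁ e₂ : Fin 3 → ℂ) (w : Fin 2 → ℂ) (p : MvPolynomial (Fin 3) ℂ) :
    MvPolynomial.eval w (MvPolynomial.aeval (slice v e₁ e₂) p) =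
      MvPolynomial.eval (v + w 0 • e₁ + w 1 • e₂) p := by
  have h : (MvPolynomial.aeval w).comp (MvPolynomial.aeval (slice v e₁ e₂))
      = MvPolynomial.aeval (v + w 0 • e₁ + w 1 • e₂) := by
    apply MvPolynomial.algHom_ext
    intro i
    simp [slice]
  have h1 := DFunLike.congr_fun h p
  rwa [AlgHom.comp_apply, MvPolynomial.aeval_eq_eval, MvPolynomial.aeval_eq_eval] at h1

theorem hasFDerivAt_eval {σ : Type*} [Fintype σ] (p : MvPolynomial σ ℂ) (w : σ → ℂ) :
    HasFDerivAt (fun w : σ → ℂ => MvPolynomial.eval w p)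
      (∑ i, MvPolynomial.eval w (MvPolynomial.pderiv i p) •
        (ContinuousLinearMap.proj i : (σ → ℂ) →L[ℂ] ℂ)) w := by
  classical
  induction p using MvPolynomial.induction_on with
  | C a =>
    simp only [MvPolynomial.eval_C]
    refine (hasFDerivAt_const a w).congr_fderiv ?_
    ext x
    simp
  | add p q hp hq =>
    have h := hp.fun_add hq
    simp only [map_add]
    refine h.congr_fderiv ?_
    ext x
    simp [add_mul, Finset.sum_add_distrib]
  | mul_X p j hp =>
    have h := hp.fun_mul (hasFDerivAt_apply (𝕜 := ℂ) j w)
    simp only [map_mul, MvPolynomial.eval_X]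
    refine h.congr_fderiv ?_
    ext x
    simp only [Derivation.leibniz, map_add, smul_eq_mul, map_mul, MvPolynomial.eval_X, add_mul,
      Finset.sum_add_distrib, MvPolynomial.pderiv_X, sum_apply,
      smul_apply, ContinuousLinearMap.proj_apply,
      add_apply, Finset.mul_sum]
    congr 1
    · rw [Finset.sum_eq_single j]
      · simp
      · intro b _ hb
        simp [hb.symm]
      · simp
    · refine Finset.sum_congr rfl fun i _ => ?_
      ring

/-! ### Singular points of an invariant curve in the plane -/

/-- The vector field is hyperbolic at `[v]`: the field that it induces on the projective plane has
two eigenvalues whose quotient is not real. -/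
def IsHyperbolicVector (F : Fin 3 → MvPolynomial (Fin 3) ℂ) (v : Fin 3 → ℂ) : Prop :=
  ∃ (e₁ e₂ : Fin 3 → ℂ) (μ l₁ l₂ c₁ c₂ : ℂ), IsUnit (Matrix.of ![v, e₁, e₂]).det ∧
    (l₁ / l₂).im ≠ 0 ∧ (∀ i, MvPolynomial.eval v (F i) = μ * v i) ∧
    (∀ i, ∑ j, e₁ j * MvPolynomial.eval v (MvPolynomial.pderiv j (F i))
      = (μ + l₁) * e₁ i + c₁ * v i) ∧
    (∀ i, ∑ j, e₂ j * MvPolynomial.eval v (MvPolynomial.pderiv j (F i))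
      = (μ + l₂) * e₂ i + c₂ * v i)

theorem vecMul_of_fin_three (v e₁ e₂ z : Fin 3 → ℂ) :
    Matrix.vecMul z (Matrix.of ![v, e₁, e₂]) = z 0 • v + z 1 • e₁ + z 2 • e₂ := by
  ext i
  simp [Matrix.vecMul, dotProduct, Fin.sum_univ_three]

theorem eq_of_frame {v e₁ e₂ : Fin 3 → ℂ} (hM : IsUnit (Matrix.of ![v, e₁, e₂]).det)
    {a b c a' b' c' : ℂ}
    (h : ∀ i, a * v i + b * e₁ i + c * e₂ i = a' * v i + b' * e₁ i + c' * e₂ i) :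
    a = a' ∧ b = b' ∧ c = c' := by
  have h1 : Matrix.vecMul ![a, b, c] (Matrix.of ![v, e₁, e₂])
      = Matrix.vecMul ![a', b', c'] (Matrix.of ![v, e₁, e₂]) := by
    rw [vecMul_of_fin_three, vecMul_of_fin_three]
    ext i
    simpa using h i
  have h2 := Matrix.vecMul_injective_of_isUnit ((Matrix.isUnit_iff_isUnit_det _).2 hM) h1
  exact ⟨by simpa using congrFun h2 0, by simpa using congrFun h2 1, by simpa using congrFun h2 2⟩

theorem isUnit_det_rotate {v e₁ e₂ : Fin 3 → ℂ} (hM : IsUnit (Matrix.of ![v, e₁, e₂]).det) :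
    IsUnit (Matrix.of ![e₂, v, e₁]).det := by
  convert hM using 1
  simp [Matrix.det_fin_three]
  ring

theorem isUnit_det_swap {v e₁ e₂ : Fin 3 → ℂ} (hM : IsUnit (Matrix.of ![v, e₁, e₂]).det) :
    IsUnit (Matrix.of ![e₁, v, e₂]).det := by
  convert hM.neg using 1
  simp [Matrix.det_fin_three]
  ring

/-- The field induced in a chart, and the invariance relation for it. -/
theorem exists_slice_field {F : Fin 3 → MvPolynomial (Fin 3) ℂ} {H K : MvPolynomial (Fin 3) ℂ}
    {n : ℕ} (hn : H.IsHomogeneous n) (hinv : ∑ i, F i * MvPolynomial.pderiv i H = K * H)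
    {v e₁ e₂ : Fin 3 → ℂ} (hM : IsUnit (Matrix.of ![v, e₁, e₂]).det) :
    ∃ f : Fin 3 → MvPolynomial (Fin 2) ℂ,
      (∀ i, MvPolynomial.aeval (slice v e₁ e₂) (F i) =
        f 0 * MvPolynomial.C (v i) + f 1 * MvPolynomial.C (e₁ i) + f 2 * MvPolynomial.C (e₂ i)) ∧
      (f 1 - MvPolynomial.X 0 * f 0) *
          MvPolynomial.pderiv 0 (MvPolynomial.aeval (slice v e₁ e₂) H)
        + (f 2 - MvPolynomial.X 1 * f 0) *
          MvPolynomial.pderiv 1 (MvPolynomial.aeval (slice v e₁ e₂) H)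
        = (MvPolynomial.aeval (slice v e₁ e₂) K - (n : MvPolynomial (Fin 2) ℂ) * f 0) *
          MvPolynomial.aeval (slice v e₁ e₂) H := by
  set M := Matrix.of ![v, e₁, e₂] with hMdef
  set α := slice v e₁ e₂ with hα
  -- These are the coordinates of `F` in the frame. Projecting to the chart removes the radial
  -- multiple `f 0`, and Euler's relation accounts for it by the term `n * f 0` in the cofactor.
  set f : Fin 3 → MvPolynomial (Fin 2) ℂ := fun j =>
    ∑ i, MvPolynomial.aeval α (F i) * MvPolynomial.C (M⁻¹ i j) with hf
  have hfF : ∀ i, MvPolynomial.aeval α (F i) =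
        f 0 * MvPolynomial.C (v i) + f 1 * MvPolynomial.C (e₁ i)
          + f 2 * MvPolynomial.C (e₂ i) := by
    intro i
    have h1 : ∀ l, ∑ j, MvPolynomial.C (σ := Fin 2) (M⁻¹ l j) * MvPolynomial.C (M j i)
        = MvPolynomial.C ((1 : Matrix (Fin 3) (Fin 3) ℂ) l i) := by
      intro l
      rw [← Matrix.nonsing_inv_mul M hM, Matrix.mul_apply, map_sum]
      simp only [map_mul]
    have h2 : ∑ j, f j * MvPolynomial.C (M j i) = MvPolynomial.aeval α (F i) := by
      simp only [hf, Finset.sum_mul, mul_assoc]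
      rw [Finset.sum_comm]
      simp only [← Finset.mul_sum, h1, Matrix.one_apply]
      rw [Finset.sum_eq_single i]
      · simp
      · intro b _ hb
        simp [hb]
      · simp
    rw [← h2, Fin.sum_univ_three]
    simp [hMdef]
  refine ⟨f, hfF, ?_⟩
  obtain ⟨d0, d1⟩ := pderiv_aeval_slice v e₁ e₂ H
  rw [d0, d1]
  have hE := congrArg (MvPolynomial.aeval α) hn.sum_X_mul_pderiv
  have hI := congrArg (MvPolynomial.aeval α) hinv
  simp only [Fin.sum_univ_three, map_add, map_mul, MvPolynomial.aeval_X, map_natCast,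
    nsmul_eq_mul, MvPolynomial.algHom_C, MvPolynomial.algebraMap_eq, hfF] at hE hI ⊢
  rw [← hα]
  simp only [hα, slice] at hE ⊢
  linear_combination hI - f 0 * hE

theorem exists_parallel_of_minors {v g : Fin 3 → ℂ} (hv : v ≠ 0)
    (h0 : v 1 * g 2 - v 2 * g 1 = 0) (h1 : v 2 * g 0 - v 0 * g 2 = 0)
    (h2 : v 0 * g 1 - v 1 * g 0 = 0) : ∃ μ : ℂ, ∀ i, g i = μ * v i := by
  obtain ⟨k, hk⟩ := Function.ne_iff.1 hv
  rw [Pi.zero_apply] at hk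
  refine ⟨g k / v k, fun i => ?_⟩
  rw [div_mul_eq_mul_div, eq_div_iff hk]
  fin_cases k <;> fin_cases i <;> simp only [Fin.zero_eta, Fin.mk_one, Fin.reduceFinMk] <;>
    first
    | rfl
    | linear_combination h0
    | linear_combination h1
    | linear_combination h2
    | linear_combination -h0
    | linear_combination -h1
    | linear_combination -h2

/-- The singular points of a reduced invariant curve are singular points of the foliation. -/
theorem exists_parallel_of_gradient_eq_zero {F : Fin 3 → MvPolynomial (Fin 3) ℂ}
    {H K : MvPolynomial (Fin 3) ℂ} {n : ℕ} (hH : Squarefree H) (hn : H.IsHomogeneous n)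
    (hn0 : n ≠ 0)
    (hinv : ∑ i, F i * MvPolynomial.pderiv i H = K * H) {v : Fin 3 → ℂ} (hv : v ≠ 0)
    (hgrad : ∀ i, MvPolynomial.eval v (MvPolynomial.pderiv i H) = 0) :
    MvPolynomial.eval v H = 0 ∧ ∃ μ : ℂ, ∀ i, MvPolynomial.eval v (F i) = μ * v i := by
  have hHv : MvPolynomial.eval v H = 0 := by
    have h := congrArg (MvPolynomial.eval v) hn.sum_X_mul_pderiv
    simp only [map_sum, map_mul, hgrad, mul_zero, Finset.sum_const_zero, map_natCast,
      nsmul_eq_mul] at h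
    exact (mul_eq_zero.1 h.symm).resolve_left (by exact_mod_cast hn0)
  refine ⟨hHv, ?_⟩
  by_contra hcon
  -- If `F(v)` is not collinear with `v`, it can serve as the first direction of a chart, where the
  -- induced field at the origin is `(1, 0)`, hence nonzero.
  set g : Fin 3 → ℂ := fun i => MvPolynomial.eval v (F i) with hg
  have hex : ∃ e₂ : Fin 3 → ℂ, IsUnit (Matrix.of ![v, g, e₂]).det := by
    by_contra hno
    push Not at hno
    apply hcon
    have h := fun k : Fin 3 => hno (Pi.single k 1)
    simp only [isUnit_iff_ne_zero, not_not, Matrix.det_fin_three] at h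
    refine exists_parallel_of_minors hv ?_ ?_ ?_
    · have := h 0
      simp at this
      linear_combination this
    · have := h 1
      simp at this
      linear_combination this
    · have := h 2
      simp at this
      linear_combination this
  obtain ⟨e₂, hM⟩ := hex
  obtain ⟨f, hf, hrel⟩ := exists_slice_field hn hinv hM
  obtain ⟨δ, hδ, a, b, hab⟩ := exists_slice_discriminant hH hn v e₂ g (isUnit_det_rotate hM)
    (i := 1) (j := 0) (α := slice v g e₂) (fun l => by simp only [slice]; ring)
  obtain ⟨d0, d1⟩ := pderiv_aeval_slice v g e₂ H
  rw [← d1] at hab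
  have hev : ∀ p, MvPolynomial.eval 0 (MvPolynomial.aeval (slice v g e₂) p)
      = MvPolynomial.eval v p := by
    intro p
    rw [eval_aeval_slice]
    simp
  have hval : MvPolynomial.eval 0 (f 0) = 0 ∧ MvPolynomial.eval 0 (f 1) = 1
      ∧ MvPolynomial.eval 0 (f 2) = 0 := by
    apply eq_of_frame hM
    intro i
    have h := congrArg (MvPolynomial.eval 0) (hf i)
    rw [hev] at h
    simp only [map_add, map_mul, MvPolynomial.eval_C] at h
    rw [← h, hg]
    ring
  refine exists_eval_ne_zero_of_field_ne_zero (i := 0) (j := 1) (by decide) hrel ?_ hδ hab ?_ ?_ ?_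
  · simp only [map_sub, map_mul, hval.1, hval.2.1, mul_zero, sub_zero]
    exact one_ne_zero
  · rw [hev, hHv]
  · rw [d0, hev]
    simp [hgrad]
  · rw [d1, hev]
    simp [hgrad]

/-- The gradient of a reduced invariant curve in a chart, at a hyperbolic singular point that is
singular on the curve. -/
theorem slice_hessian {F : Fin 3 → MvPolynomial (Fin 3) ℂ}
    {H K : MvPolynomial (Fin 3) ℂ} {n : ℕ} (hH : Squarefree H) (hn : H.IsHomogeneous n)
    (hinv : ∑ i, F i * MvPolynomial.pderiv i H = K * H) {v e₁ e₂ : Fin 3 → ℂ}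
    {μ l₁ l₂ c₁ c₂ : ℂ} (hM : IsUnit (Matrix.of ![v, e₁, e₂]).det)
    (him : (l₁ / l₂).im ≠ 0) (hμ : ∀ i, MvPolynomial.eval v (F i) = μ * v i)
    (he₁ : ∀ i, ∑ j, e₁ j * MvPolynomial.eval v (MvPolynomial.pderiv j (F i))
      = (μ + l₁) * e₁ i + c₁ * v i)
    (he₂ : ∀ i, ∑ j, e₂ j * MvPolynomial.eval v (MvPolynomial.pderiv j (F i))
      = (μ + l₂) * e₂ i + c₂ * v i)
    (hHv : MvPolynomial.eval v H = 0)
    (hgrad : ∀ i, MvPolynomial.eval v (MvPolynomial.pderiv i H) = 0)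
    {h : MvPolynomial (Fin 2) ℂ} (hh : h = MvPolynomial.aeval (slice v e₁ e₂) H) :
    MvPolynomial.eval 0 (MvPolynomial.pderiv 0 h) = 0 ∧
    MvPolynomial.eval 0 (MvPolynomial.pderiv 1 h) = 0 ∧
    MvPolynomial.eval 0 (MvPolynomial.pderiv 0 (MvPolynomial.pderiv 0 h)) = 0 ∧
    MvPolynomial.eval 0 (MvPolynomial.pderiv 1 (MvPolynomial.pderiv 1 h)) = 0 ∧
    MvPolynomial.eval 0 (MvPolynomial.pderiv 1 (MvPolynomial.pderiv 0 h)) ≠ 0 := by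
  obtain ⟨f, hf, hrel⟩ := exists_slice_field hn hinv hM
  obtain ⟨δ₀, hδ₀, a₀, b₀, hab₀⟩ := exists_slice_discriminant hH hn v e₂ e₁ (isUnit_det_rotate hM)
    (i := 1) (j := 0) (α := slice v e₁ e₂) (fun l => by simp only [slice]; ring)
  obtain ⟨δ₁, hδ₁, a₁, b₁, hab₁⟩ := exists_slice_discriminant hH hn v e₁ e₂ (isUnit_det_swap hM)
    (i := 0) (j := 1) (α := slice v e₁ e₂) (fun l => by simp only [slice])
  obtain ⟨d0, d1⟩ := pderiv_aeval_slice v e₁ e₂ H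
  rw [← d1] at hab₀
  rw [← d0] at hab₁
  have hev : ∀ p, MvPolynomial.eval 0 (MvPolynomial.aeval (slice v e₁ e₂) p)
      = MvPolynomial.eval v p := by
    intro p
    rw [eval_aeval_slice]
    simp
  have h00 : MvPolynomial.eval 0 (MvPolynomial.pderiv 0 h) = 0 := by
    rw [hh, d0, hev]
    simp [hgrad]
  have h01 : MvPolynomial.eval 0 (MvPolynomial.pderiv 1 h) = 0 := by
    rw [hh, d1, hev]
    simp [hgrad]
  have hval : MvPolynomial.eval 0 (f 0) = μ ∧ MvPolynomial.eval 0 (f 1) = 0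
      ∧ MvPolynomial.eval 0 (f 2) = 0 := by
    apply eq_of_frame hM
    intro i
    have h := congrArg (MvPolynomial.eval 0) (hf i)
    rw [hev] at h
    simp only [map_add, map_mul, MvPolynomial.eval_C] at h
    rw [← h, hμ]
    ring
  have hder : ∀ (k : Fin 2) (e : Fin 3 → ℂ) (i : Fin 3),
      MvPolynomial.pderiv k (MvPolynomial.aeval (slice v e₁ e₂) (F i)) =
        MvPolynomial.aeval (slice v e₁ e₂)
          (∑ l, MvPolynomial.C (e l) * MvPolynomial.pderiv l (F i)) →
      MvPolynomial.eval 0 (MvPolynomial.pderiv k (f 0)) * v i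
        + MvPolynomial.eval 0 (MvPolynomial.pderiv k (f 1)) * e₁ i
        + MvPolynomial.eval 0 (MvPolynomial.pderiv k (f 2)) * e₂ i
        = ∑ j, e j * MvPolynomial.eval v (MvPolynomial.pderiv j (F i)) := by
    intro k e i hk
    have h := congrArg (MvPolynomial.eval 0) hk
    rw [hev, hf i] at h
    simp only [map_add, map_sum, map_mul, Derivation.leibniz, smul_eq_mul, MvPolynomial.pderiv_C,
      mul_zero, zero_add, MvPolynomial.eval_C] at h
    rw [← h]
    ring
  have hd0 : MvPolynomial.eval 0 (MvPolynomial.pderiv 0 (f 0)) = c₁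
      ∧ MvPolynomial.eval 0 (MvPolynomial.pderiv 0 (f 1)) = μ + l₁
      ∧ MvPolynomial.eval 0 (MvPolynomial.pderiv 0 (f 2)) = 0 := by
    apply eq_of_frame hM
    intro i
    rw [hder 0 e₁ i (pderiv_aeval_slice v e₁ e₂ (F i)).1, he₁]
    ring
  have hd1 : MvPolynomial.eval 0 (MvPolynomial.pderiv 1 (f 0)) = c₂
      ∧ MvPolynomial.eval 0 (MvPolynomial.pderiv 1 (f 1)) = 0
      ∧ MvPolynomial.eval 0 (MvPolynomial.pderiv 1 (f 2)) = μ + l₂ := by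
    apply eq_of_frame hM
    intro i
    rw [hder 1 e₂ i (pderiv_aeval_slice v e₁ e₂ (F i)).2, he₂]
    ring
  rw [← hh] at hab₀ hab₁ hrel
  -- Subtracting the radial part `x f₀`, `y f₀` cancels `μ`, so the linear part of the chart field
  -- is diagonal with entries `l₁`, `l₂`.
  refine ⟨h00, h01, hessian_of_hyperbolic (l₁ := l₁) (l₂ := l₂) ?_ ?_ ?_ ?_ ?_ ?_ him hrel hδ₀ hδ₁
    hab₀ hab₁ (by rw [hh, hev, hHv]) h00 h01⟩
  · simp only [map_sub, map_mul, hval, MvPolynomial.eval_X, Pi.zero_apply]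
    ring
  · simp only [map_sub, map_mul, hval, MvPolynomial.eval_X, Pi.zero_apply]
    ring
  · simp only [map_sub, map_add, map_mul, hval, hd0, MvPolynomial.eval_X, Pi.zero_apply,
      Derivation.leibniz, smul_eq_mul, MvPolynomial.pderiv_X_self, map_one]
    ring
  · simp only [map_sub, map_add, map_mul, hval, hd1, MvPolynomial.eval_X, Pi.zero_apply,
      Derivation.leibniz, smul_eq_mul, MvPolynomial.pderiv_X_of_ne (show (0 : Fin 2) ≠ 1 by decide),
      map_zero]
    ring
  · simp only [map_sub, map_add, map_mul, hval, hd0, MvPolynomial.eval_X, Pi.zero_apply,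
      Derivation.leibniz, smul_eq_mul, MvPolynomial.pderiv_X_of_ne (show (1 : Fin 2) ≠ 0 by decide),
      map_zero]
    ring
  · simp only [map_sub, map_add, map_mul, hval, hd1, MvPolynomial.eval_X, Pi.zero_apply,
      Derivation.leibniz, smul_eq_mul, MvPolynomial.pderiv_X_self, map_one]
    ring

/-! ### Bounds by the gradient -/

open Asymptotics Topology in
/-- A function of two variables vanishing at a nondegenerate critical point is controlled by the
gradient. -/
theorem isBigO_gradient_of_hessian {h p : MvPolynomial (Fin 2) ℂ}
    (hp : MvPolynomial.eval 0 p = 0)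
    (h0 : MvPolynomial.eval 0 (MvPolynomial.pderiv 0 h) = 0)
    (h1 : MvPolynomial.eval 0 (MvPolynomial.pderiv 1 h) = 0)
    (h00 : MvPolynomial.eval 0 (MvPolynomial.pderiv 0 (MvPolynomial.pderiv 0 h)) = 0)
    (h11 : MvPolynomial.eval 0 (MvPolynomial.pderiv 1 (MvPolynomial.pderiv 1 h)) = 0)
    (h10 : MvPolynomial.eval 0 (MvPolynomial.pderiv 1 (MvPolynomial.pderiv 0 h)) ≠ 0) :
    (fun w : Fin 2 → ℂ => MvPolynomial.eval w p) =O[𝓝 0]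
      (fun (w : Fin 2 → ℂ) (k : Fin 2) => MvPolynomial.eval w (MvPolynomial.pderiv k h)) := by
  set c := MvPolynomial.eval 0 (MvPolynomial.pderiv 1 (MvPolynomial.pderiv 0 h)) with hc
  have hp1 : (fun w : Fin 2 → ℂ => MvPolynomial.eval w p) =O[𝓝 0] fun w => w := by
    have h := (hasFDerivAt_eval p 0).isBigO_sub
    simpa only [hp, sub_zero] using h
  have h01 : MvPolynomial.eval 0 (MvPolynomial.pderiv 0 (MvPolynomial.pderiv 1 h)) = c := by
    rw [pderiv_comm]
  have e0 := (hasFDerivAt_eval (MvPolynomial.pderiv 0 h) 0).isLittleO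
  have e1 := (hasFDerivAt_eval (MvPolynomial.pderiv 1 h) 0).isLittleO
  simp only [Fin.sum_univ_two, h0, h1, h00, h11, h01, ← hc, sub_zero] at e0 e1
  have e : (fun w : Fin 2 → ℂ => (fun k : Fin 2 =>
      MvPolynomial.eval w (MvPolynomial.pderiv k h)) - ![c * w 1, c * w 0]) =o[𝓝 0]
      (fun w : Fin 2 → ℂ => w) := by
    rw [isLittleO_pi]
    intro k
    fin_cases k
    · exact e0.congr_left fun w => by simp
    · exact e1.congr_left fun w => by simp
  -- The linear part of the gradient is invertible, so `w` is dominated by it, and the error `o(w)`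
  -- can be absorbed.
  have hL : (fun w : Fin 2 → ℂ => w) =O[𝓝 0] fun w : Fin 2 → ℂ => ![c * w 1, c * w 0] := by
    refine IsBigO.of_bound ‖c‖⁻¹ (Filter.Eventually.of_forall fun w => ?_)
    have hc0 : 0 < ‖c‖ := norm_pos_iff.2 h10
    rw [inv_mul_eq_div, le_div_iff₀ hc0, mul_comm]
    rw [← norm_smul, pi_norm_le_iff_of_nonneg (norm_nonneg _)]
    intro k
    fin_cases k
    · exact norm_le_pi_norm ![c * w 1, c * w 0] 1
    · exact norm_le_pi_norm ![c * w 1, c * w 0] 0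
  have h2 := (e.trans_isBigO hL).right_isBigO_add
  simp only [sub_add_cancel] at h2
  exact (hp1.trans hL).trans h2

open Asymptotics Topology in
/-- A homogeneous polynomial that vanishes on the singular set of the foliation is locally
controlled by the gradient of a reduced invariant curve. -/
theorem isBigO_gradient {F : Fin 3 → MvPolynomial (Fin 3) ℂ} {H K P : MvPolynomial (Fin 3) ℂ}
    {n m : ℕ} (hH : Squarefree H) (hn : H.IsHomogeneous n) (hn0 : n ≠ 0)
    (hinv : ∑ i, F i * MvPolynomial.pderiv i H = K * H) (hP : P.IsHomogeneous m)
    {v : Fin 3 → ℂ} (hv : v ≠ 0)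
    (hsing : (∃ μ : ℂ, ∀ i, MvPolynomial.eval v (F i) = μ * v i) →
      IsHyperbolicVector F v ∧ MvPolynomial.eval v P = 0) :
    (fun u : Fin 3 → ℂ => MvPolynomial.eval u P) =O[𝓝 v]
      (fun (u : Fin 3 → ℂ) (k : Fin 3) => MvPolynomial.eval u (MvPolynomial.pderiv k H)) := by
  by_cases hgrad : ∀ i, MvPolynomial.eval v (MvPolynomial.pderiv i H) = 0
  · obtain ⟨hHv, hpar⟩ := exists_parallel_of_gradient_eq_zero hH hn hn0 hinv hv hgrad
    obtain ⟨⟨e₁, e₂, μ, l₁, l₂, c₁, c₂, hM, him, hμ, he₁, he₂⟩, hPv⟩ := hsing hpar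
    obtain ⟨h0, h1, h00, h11, h10⟩ := slice_hessian hH hn hinv hM him hμ he₁ he₂ hHv hgrad rfl
    have hp0 : MvPolynomial.eval 0 (MvPolynomial.aeval (slice v e₁ e₂) P) = 0 := by
      rw [eval_aeval_slice]
      simp [hPv]
    have hslice := isBigO_gradient_of_hessian hp0 h0 h1 h00 h11 h10
    obtain ⟨d0, d1⟩ := pderiv_aeval_slice v e₁ e₂ H
    have hg : (fun (w : Fin 2 → ℂ) (k : Fin 2) => MvPolynomial.eval w
        (MvPolynomial.pderiv k (MvPolynomial.aeval (slice v e₁ e₂) H))) =O[𝓝 0]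
        (fun (w : Fin 2 → ℂ) (k : Fin 3) =>
          MvPolynomial.eval (v + w 0 • e₁ + w 1 • e₂) (MvPolynomial.pderiv k H)) := by
      have hsum : ∀ e : Fin 3 → ℂ, (fun w : Fin 2 → ℂ => ∑ k, e k *
          MvPolynomial.eval (v + w 0 • e₁ + w 1 • e₂) (MvPolynomial.pderiv k H)) =O[𝓝 0]
          (fun (w : Fin 2 → ℂ) (k : Fin 3) =>
            MvPolynomial.eval (v + w 0 • e₁ + w 1 • e₂) (MvPolynomial.pderiv k H)) := by
        intro e
        refine IsBigO.fun_sum fun k _ => IsBigO.const_mul_left ?_ _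
        exact IsBigO.of_bound 1 (Filter.Eventually.of_forall fun w => by
          rw [one_mul]
          exact norm_le_pi_norm (fun k : Fin 3 =>
            MvPolynomial.eval (v + w 0 • e₁ + w 1 • e₂) (MvPolynomial.pderiv k H)) k)
      rw [isBigO_pi]
      intro k
      fin_cases k
      · refine (hsum e₁).congr_left fun w => ?_
        change _ = MvPolynomial.eval w
          (MvPolynomial.pderiv 0 (MvPolynomial.aeval (slice v e₁ e₂) H))
        rw [d0, eval_aeval_slice]
        simp
      · refine (hsum e₂).congr_left fun w => ?_
        change _ = MvPolynomial.eval w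
          (MvPolynomial.pderiv 1 (MvPolynomial.aeval (slice v e₁ e₂) H))
        rw [d1, eval_aeval_slice]
        simp
    have hloc := hslice.trans hg
    simp only [eval_aeval_slice] at hloc
    -- The estimate on the slice spreads to a neighbourhood of `v` by homogeneity: a nearby `u` with
    -- frame coordinates `z` is `z 0` times the slice point with coordinates `z 1 / z 0` and `z 2 /
    -- z 0`.
    set M := Matrix.of ![v, e₁, e₂] with hMdef
    have hz : Continuous fun u : Fin 3 → ℂ => Matrix.vecMul u M⁻¹ :=
      Continuous.matrix_vecMul continuous_id continuous_const
    have hzu : ∀ u : Fin 3 → ℂ, u = (Matrix.vecMul u M⁻¹) 0 • v + (Matrix.vecMul u M⁻¹) 1 • e₁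
        + (Matrix.vecMul u M⁻¹) 2 • e₂ := by
      intro u
      rw [← vecMul_of_fin_three, ← hMdef, Matrix.vecMul_vecMul, Matrix.nonsing_inv_mul M hM,
        Matrix.vecMul_one]
    obtain ⟨hz0, hz1, hz2⟩ := eq_of_frame hM (a := (Matrix.vecMul v M⁻¹) 0)
      (b := (Matrix.vecMul v M⁻¹) 1) (c := (Matrix.vecMul v M⁻¹) 2) (a' := 1) (b' := 0) (c' := 0)
      (fun i => by
        have := congrFun (hzu v) i
        simp only [Pi.add_apply, Pi.smul_apply, smul_eq_mul] at this
        rw [← this]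
        ring)
    have hc0 : ContinuousAt (fun u : Fin 3 → ℂ => (Matrix.vecMul u M⁻¹) 0) v :=
      ((continuous_apply 0).comp hz).continuousAt
    have hc1 : ContinuousAt (fun u : Fin 3 → ℂ => (Matrix.vecMul u M⁻¹) 1) v :=
      ((continuous_apply 1).comp hz).continuousAt
    have hc2 : ContinuousAt (fun u : Fin 3 → ℂ => (Matrix.vecMul u M⁻¹) 2) v :=
      ((continuous_apply 2).comp hz).continuousAt
    have hne : (Matrix.vecMul v M⁻¹) 0 ≠ 0 := by rw [hz0]; exact one_ne_zero
    have hev : ∀ᶠ u in 𝓝 v, (Matrix.vecMul u M⁻¹) 0 ≠ 0 := hc0.eventually_ne hne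
    have hρ : Filter.Tendsto (fun u : Fin 3 → ℂ =>
        ![(Matrix.vecMul u M⁻¹) 1 / (Matrix.vecMul u M⁻¹) 0,
          (Matrix.vecMul u M⁻¹) 2 / (Matrix.vecMul u M⁻¹) 0]) (𝓝 v) (𝓝 0) := by
      rw [tendsto_pi_nhds]
      intro k
      fin_cases k
      · have h := hc1.tendsto.div hc0.tendsto hne
        rw [hz1, zero_div] at h
        exact h
      · have h := hc2.tendsto.div hc0.tendsto hne
        rw [hz2, zero_div] at h
        exact h
    have hrescale : ∀ (q : MvPolynomial (Fin 3) ℂ) (l : ℕ), q.IsHomogeneous l → ∀ u : Fin 3 → ℂ,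
        (Matrix.vecMul u M⁻¹) 0 ≠ 0 → MvPolynomial.eval u q = (Matrix.vecMul u M⁻¹) 0 ^ l *
          MvPolynomial.eval (v + ((Matrix.vecMul u M⁻¹) 1 / (Matrix.vecMul u M⁻¹) 0) • e₁
            + ((Matrix.vecMul u M⁻¹) 2 / (Matrix.vecMul u M⁻¹) 0) • e₂) q := by
      intro q l hq u hu
      rw [← eval_smul_of_isHomogeneous hq, smul_add, smul_add, smul_smul, smul_smul,
        mul_div_cancel₀ _ hu, mul_div_cancel₀ _ hu, ← hzu u]
    have hcomp := hloc.comp_tendsto hρ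
    have hbd : (fun u : Fin 3 → ℂ => (Matrix.vecMul u M⁻¹) 0 ^ m *
        ((Matrix.vecMul u M⁻¹) 0 ^ (n - 1))⁻¹) =O[𝓝 v] fun _ => (1 : ℝ) :=
      ((hc0.pow m).mul ((hc0.pow (n - 1)).inv₀ (pow_ne_zero _ hne))).isBigO_one ℝ
    have hgr : (fun u : Fin 3 → ℂ => MvPolynomial.eval u P) =O[𝓝 v] fun u : Fin 3 → ℂ =>
        ((Matrix.vecMul u M⁻¹) 0 ^ (n - 1)) • fun k : Fin 3 => MvPolynomial.eval (v
            + ((Matrix.vecMul u M⁻¹) 1 / (Matrix.vecMul u M⁻¹) 0) • e₁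
            + ((Matrix.vecMul u M⁻¹) 2 / (Matrix.vecMul u M⁻¹) 0) • e₂)
              (MvPolynomial.pderiv k H) := by
      have h3 : (fun u : Fin 3 → ℂ => (Matrix.vecMul u M⁻¹) 0 ^ m) =O[𝓝 v]
          fun u : Fin 3 → ℂ => (Matrix.vecMul u M⁻¹) 0 ^ (n - 1) := by
        have h4 := hbd.mul (isBigO_refl (fun u : Fin 3 → ℂ => (Matrix.vecMul u M⁻¹) 0 ^ (n - 1))
          (𝓝 v)).norm_right
        refine (h4.congr' ?_ ?_).of_norm_right
        · filter_upwards [hev] with u hu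
          rw [inv_mul_cancel_right₀ (pow_ne_zero _ hu)]
        · exact Filter.Eventually.of_forall fun u => one_mul _
      refine (h3.smul hcomp).congr' ?_ (Filter.EventuallyEq.refl _ _)
      filter_upwards [hev] with u hu
      rw [hrescale P m hP u hu]
      simp [smul_eq_mul]
    refine hgr.congr' (Filter.EventuallyEq.refl _ _) ?_
    filter_upwards [hev] with u hu
    ext k
    rw [hrescale _ (n - 1) hn.pderiv u hu]
    simp
  · push Not at hgrad
    obtain ⟨i, hi⟩ := hgrad
    have hcont : ∀ q : MvPolynomial (Fin 3) ℂ,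
        ContinuousAt (fun u : Fin 3 → ℂ => MvPolynomial.eval u q) v :=
      fun q => (hasFDerivAt_eval q v).continuousAt
    have h1 : (fun u : Fin 3 → ℂ => MvPolynomial.eval u P) =O[𝓝 v] fun _ => (1 : ℂ) :=
      (hcont P).isBigO_one ℂ
    have h2 : (fun _ => (1 : ℂ)) =O[𝓝 v] fun u : Fin 3 → ℂ =>
        MvPolynomial.eval u (MvPolynomial.pderiv i H) := by
      have hpos : 0 < ‖MvPolynomial.eval v (MvPolynomial.pderiv i H)‖ := norm_pos_iff.2 hi
      refine (isBigO_const_left_iff_pos_le_norm one_ne_zero).2 ⟨_, half_pos hpos, ?_⟩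
      filter_upwards [(hcont (MvPolynomial.pderiv i H)).norm.eventually_const_lt
        (half_lt_self hpos)] with u hu using hu.le
    refine (h1.trans h2).trans (IsBigO.of_bound 1 (Filter.Eventually.of_forall fun u => ?_))
    rw [one_mul]
    exact norm_le_pi_norm (fun k : Fin 3 => MvPolynomial.eval u (MvPolynomial.pderiv k H)) i

/-- The global form of the control by the gradient. -/
theorem exists_norm_le_gradient {F : Fin 3 → MvPolynomial (Fin 3) ℂ}
    {H K P : MvPolynomial (Fin 3) ℂ}
    {n m : ℕ} (hH : Squarefree H) (hn : H.IsHomogeneous n) (hn0 : n ≠ 0)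
    (hinv : ∑ i, F i * MvPolynomial.pderiv i H = K * H) (hP : P.IsHomogeneous m)
    (hsing : ∀ v : Fin 3 → ℂ, v ≠ 0 → (∃ μ : ℂ, ∀ i, MvPolynomial.eval v (F i) = μ * v i) →
      IsHyperbolicVector F v ∧ MvPolynomial.eval v P = 0) :
    ∃ C : ℝ, 0 ≤ C ∧ ∀ u : Fin 3 → ℂ, u ≠ 0 → ‖u‖ ^ (n - 1) * ‖MvPolynomial.eval u P‖ ≤
      C * (‖u‖ ^ m * ‖fun k : Fin 3 => MvPolynomial.eval u (MvPolynomial.pderiv k H)‖) := by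
  -- The local constants are combined by compactness of the unit sphere; scaling then gives the
  -- weights.
  have hcomp : ∃ C : ℝ, 0 ≤ C ∧ ∀ u ∈ Metric.sphere (0 : Fin 3 → ℂ) 1, ‖MvPolynomial.eval u P‖ ≤
      C * ‖fun k : Fin 3 => MvPolynomial.eval u (MvPolynomial.pderiv k H)‖ := by
    refine (isCompact_sphere (0 : Fin 3 → ℂ) 1).induction_on
      (p := fun S => ∃ C : ℝ, 0 ≤ C ∧ ∀ u ∈ S, ‖MvPolynomial.eval u P‖ ≤
      C * ‖fun k : Fin 3 => MvPolynomial.eval u (MvPolynomial.pderiv k H)‖) ?_ ?_ ?_ ?_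
    · exact ⟨0, le_rfl, fun u hu => hu.elim⟩
    · rintro S T hST ⟨C, hC, h⟩
      exact ⟨C, hC, fun u hu => h u (hST hu)⟩
    · rintro S T ⟨C, hC, h⟩ ⟨C', hC', h'⟩
      refine ⟨C + C', by positivity, fun u hu => ?_⟩
      have hpos := norm_nonneg (fun k : Fin 3 => MvPolynomial.eval u (MvPolynomial.pderiv k H))
      rcases hu with hu | hu
      · refine (h u hu).trans ?_
        nlinarith
      · refine (h' u hu).trans ?_
        nlinarith
    · intro v hv
      have hv0 : v ≠ 0 := by
        rintro rfl
        simp at hv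
      obtain ⟨C, hC⟩ := (isBigO_gradient hH hn hn0 hinv hP hv0 (hsing v hv0)).bound
      refine ⟨_, mem_nhdsWithin_of_mem_nhds hC, |C|, abs_nonneg C, fun u hu => ?_⟩
      exact (show _ ≤ _ from hu).trans
        (mul_le_mul_of_nonneg_right (le_abs_self C) (norm_nonneg _))
  obtain ⟨C, hC0, hC⟩ := hcomp
  refine ⟨C, hC0, fun u hu => ?_⟩
  have hpos : 0 < ‖u‖ := norm_pos_iff.2 hu
  set c : ℂ := (‖u‖ : ℂ) with hc
  have hc0 : c ≠ 0 := by
    rw [hc]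
    exact_mod_cast hpos.ne'
  have hcn : ‖c‖ = ‖u‖ := by simp [hc]
  set u₁ := c⁻¹ • u with hu₁
  have huu : u = c • u₁ := by rw [hu₁, smul_smul, mul_inv_cancel₀ hc0, one_smul]
  have h1 := hC u₁ (by
    rw [mem_sphere_zero_iff_norm, hu₁, norm_smul, norm_inv, hcn, inv_mul_cancel₀ hpos.ne'])
  have hPu : ‖MvPolynomial.eval u P‖ = ‖u‖ ^ m * ‖MvPolynomial.eval u₁ P‖ := by
    conv_lhs => rw [huu, eval_smul_of_isHomogeneous hP, norm_mul, norm_pow, hcn]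
  have hHu : ‖fun k : Fin 3 => MvPolynomial.eval u (MvPolynomial.pderiv k H)‖ =
      ‖u‖ ^ (n - 1) * ‖fun k : Fin 3 => MvPolynomial.eval u₁ (MvPolynomial.pderiv k H)‖ := by
    rw [← hcn, ← norm_pow, ← norm_smul]
    congr 1
    ext k
    conv_lhs => rw [huu, eval_smul_of_isHomogeneous hn.pderiv]
    rfl
  rw [hPu, hHu]
  have h2 : 0 ≤ ‖u‖ ^ (n - 1) * ‖u‖ ^ m := by positivity
  nlinarith [mul_le_mul_of_nonneg_left h1 h2]

/-! ### The minors and the isolation of singular points -/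

/-- The minors of the matrix formed by the radial field and the given field: they define the
singular set. -/
noncomputable def minorPoly (F : Fin 3 → MvPolynomial (Fin 3) ℂ) :
    Fin 3 → MvPolynomial (Fin 3) ℂ :=
  ![MvPolynomial.X 1 * F 2 - MvPolynomial.X 2 * F 1,
    MvPolynomial.X 2 * F 0 - MvPolynomial.X 0 * F 2,
    MvPolynomial.X 0 * F 1 - MvPolynomial.X 1 * F 0]

theorem minorPoly_isHomogeneous {F : Fin 3 → MvPolynomial (Fin 3) ℂ} {d : ℕ}
    (hF : ∀ i, (F i).IsHomogeneous d) (k : Fin 3) : (minorPoly F k).IsHomogeneous (1 + d) := by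
  have h := fun i j => (MvPolynomial.isHomogeneous_X ℂ (i : Fin 3)).mul (hF j)
  fin_cases k <;> exact (h _ _).sub (h _ _)

theorem eval_minorPoly_eq_zero {F : Fin 3 → MvPolynomial (Fin 3) ℂ} {v : Fin 3 → ℂ}
    (h : ∃ μ : ℂ, ∀ i, MvPolynomial.eval v (F i) = μ * v i) (k : Fin 3) :
    MvPolynomial.eval v (minorPoly F k) = 0 := by
  obtain ⟨μ, hμ⟩ := h
  fin_cases k <;> simp [minorPoly, hμ] <;> ring

theorem dvd_minors_of_three {A : Type*} [CommRing A] {h : A} {w p : Fin 3 → A}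
    (h01 : h ∣ w 0 * p 1 - w 1 * p 0) (h12 : h ∣ w 1 * p 2 - w 2 * p 1)
    (h20 : h ∣ w 2 * p 0 - w 0 * p 2) (i j : Fin 3) : h ∣ w i * p j - w j * p i := by
  fin_cases i <;> fin_cases j <;> simp only [Fin.zero_eta, Fin.mk_one, Fin.reduceFinMk, sub_self,
    dvd_zero, h01, h12, h20] <;> rw [dvd_sub_comm] <;> assumption

/-- Along an invariant curve the minors are proportional to the gradient. -/
theorem minorPoly_mul_pderiv {F : Fin 3 → MvPolynomial (Fin 3) ℂ} {H K : MvPolynomial (Fin 3) ℂ}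
    {n : ℕ} (hn : H.IsHomogeneous n) (hinv : ∑ i, F i * MvPolynomial.pderiv i H = K * H)
    (i j : Fin 3) :
    H ∣ minorPoly F i * MvPolynomial.pderiv j H - minorPoly F j * MvPolynomial.pderiv i H := by
  have hE := hn.sum_X_mul_pderiv
  rw [Fin.sum_univ_three, nsmul_eq_mul] at hE
  rw [Fin.sum_univ_three] at hinv
  -- The quotients are the components of `(z × F) × ∇H = (z·∇H) F - (F·∇H) z = H (n F - K z)`.
  have h12 : H ∣ minorPoly F 1 * MvPolynomial.pderiv 2 H
      - minorPoly F 2 * MvPolynomial.pderiv 1 H := by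
    refine ⟨(n : MvPolynomial (Fin 3) ℂ) * F 0 - MvPolynomial.X 0 * K, ?_⟩
    simp only [minorPoly, Matrix.cons_val]
    linear_combination F 0 * hE - MvPolynomial.X 0 * hinv
  have h20 : H ∣ minorPoly F 2 * MvPolynomial.pderiv 0 H
      - minorPoly F 0 * MvPolynomial.pderiv 2 H := by
    refine ⟨(n : MvPolynomial (Fin 3) ℂ) * F 1 - MvPolynomial.X 1 * K, ?_⟩
    simp only [minorPoly, Matrix.cons_val]
    linear_combination F 1 * hE - MvPolynomial.X 1 * hinv
  have h01 : H ∣ minorPoly F 0 * MvPolynomial.pderiv 1 H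
      - minorPoly F 1 * MvPolynomial.pderiv 0 H := by
    refine ⟨(n : MvPolynomial (Fin 3) ℂ) * F 2 - MvPolynomial.X 2 * K, ?_⟩
    simp only [minorPoly, Matrix.cons_val]
    linear_combination F 2 * hE - MvPolynomial.X 2 * hinv
  exact dvd_minors_of_three (p := fun k => MvPolynomial.pderiv k H) h01 h12 h20 i j

/-- Hyperbolic singular points are isolated: no curve consists of singular points. -/
theorem not_forall_dvd_minorPoly {F : Fin 3 → MvPolynomial (Fin 3) ℂ}
    (hyp : ∀ v : Fin 3 → ℂ, v ≠ 0 → (∃ μ : ℂ, ∀ i, MvPolynomial.eval v (F i) = μ * v i) →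
      IsHyperbolicVector F v) {f : MvPolynomial (Fin 3) ℂ} {v : Fin 3 → ℂ} (hv : v ≠ 0)
    (hfv : MvPolynomial.eval v f = 0) (hdvd : ∀ k, f ∣ minorPoly F k) : False := by
  choose G hG using hdvd
  have hz : ∀ k, MvPolynomial.eval v (minorPoly F k) = 0 := fun k => by
    rw [hG, map_mul, hfv, zero_mul]
  have hpar : ∃ μ : ℂ, ∀ i, MvPolynomial.eval v (F i) = μ * v i := by
    refine exists_parallel_of_minors hv ?_ ?_ ?_
    · simpa [minorPoly] using hz 0
    · simpa [minorPoly] using hz 1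
    · simpa [minorPoly] using hz 2
  obtain ⟨e₁, e₂, μ, l₁, l₂, c₁, c₂, hM, him, hμ, he₁, he₂⟩ := hyp v hv hpar
  have hl₁ : l₁ ≠ 0 := by
    rintro rfl
    simp at him
  have hl₂ : l₂ ≠ 0 := by
    rintro rfl
    simp at him
  set D : (Fin 3 → ℂ) → MvPolynomial (Fin 3) ℂ → ℂ :=
    fun e p => ∑ j, e j * MvPolynomial.eval v (MvPolynomial.pderiv j p) with hD
  have hDmul : ∀ e p q, D e (p * q) =
      D e p * MvPolynomial.eval v q + MvPolynomial.eval v p * D e q := by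
    intro e p q
    simp only [hD, Fin.sum_univ_three, Derivation.leibniz, map_add, smul_eq_mul, map_mul]
    ring
  have hDX : ∀ e i, D e (MvPolynomial.X i) = e i := by
    intro e i
    simp [hD, MvPolynomial.pderiv_X, Pi.single_apply, apply_ite]
  have hDsub : ∀ e p q, D e (p - q) = D e p - D e q := by
    intro e p q
    simp only [hD, map_sub, mul_sub, Finset.sum_sub_distrib]
  -- At `v` the derivative of `z × F` along an eigendirection `e` is `l (v × e)`, and divisibility
  -- by `f` makes it a multiple of `G(v)`. For `e₁` and `e₂` this would give two independent vectors
  -- on one line.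
  have hmin : ∀ (e : Fin 3 → ℂ) (l c : ℂ), (∀ i, D e (F i) = (μ + l) * e i + c * v i) →
      l * (v 1 * e 2 - v 2 * e 1) = D e f * MvPolynomial.eval v (G 0) ∧
      l * (v 2 * e 0 - v 0 * e 2) = D e f * MvPolynomial.eval v (G 1) ∧
      l * (v 0 * e 1 - v 1 * e 0) = D e f * MvPolynomial.eval v (G 2) := by
    intro e l c he
    have h := fun k => congrArg (D e) (hG k)
    simp only [hDmul e f, hfv, zero_mul, add_zero] at h
    refine ⟨?_, ?_, ?_⟩
    · rw [← h 0]
      simp [minorPoly, hDsub, hDmul, hDX, he, hμ]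
      ring
    · rw [← h 1]
      simp [minorPoly, hDsub, hDmul, hDX, he, hμ]
      ring
    · rw [← h 2]
      simp [minorPoly, hDsub, hDmul, hDX, he, hμ]
      ring
  obtain ⟨a0, a1, a2⟩ := hmin e₁ l₁ c₁ he₁
  obtain ⟨b0, b1, b2⟩ := hmin e₂ l₂ c₂ he₂
  have hdet := isUnit_iff_ne_zero.1 hM
  simp only [Matrix.det_fin_three, Matrix.of_apply, Matrix.cons_val] at hdet
  set g := MvPolynomial.eval v (G 0) * e₂ 0 + MvPolynomial.eval v (G 1) * e₂ 1
    + MvPolynomial.eval v (G 2) * e₂ 2 with hg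
  set g' := MvPolynomial.eval v (G 0) * e₁ 0 + MvPolynomial.eval v (G 1) * e₁ 1
    + MvPolynomial.eval v (G 2) * e₁ 2 with hg'
  have r1 : D e₂ f * g = 0 := by
    rw [hg]
    linear_combination -(e₂ 0 * b0 + e₂ 1 * b1 + e₂ 2 * b2)
  rcases mul_eq_zero.1 r1 with h | h
  · refine mul_ne_zero hl₂ hdet ?_
    linear_combination -(e₁ 0 * b0 + e₁ 1 * b1 + e₁ 2 * b2) - g' * h
  · refine mul_ne_zero hl₁ hdet ?_
    linear_combination (e₂ 0 * a0 + e₂ 1 * a1 + e₂ 2 * a2) + D e₁ f * h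

/-! ### The degree bound -/

theorem exists_frame {a : Fin 3 → ℂ} (ha : a ≠ 0) :
    ∃ b c : Fin 3 → ℂ, IsUnit (Matrix.of ![a, b, c]).det := by
  obtain ⟨k, hk⟩ := Function.ne_iff.1 ha
  rw [Pi.zero_apply] at hk
  refine ⟨Pi.single (k + 1) 1, Pi.single (k + 2) 1, isUnit_iff_ne_zero.2 ?_⟩
  fin_cases k <;> simp [Matrix.det_fin_three] <;> exact hk

theorem norm_prod_map_le_of_forall {c : ℝ} (hc : 0 ≤ c) (s : Multiset ℂ) {f g : ℂ → ℂ}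
    (h : ∀ w ∈ s, ‖f w‖ ≤ c * ‖g w‖) :
    ‖(s.map f).prod‖ ≤ c ^ s.card * ‖(s.map g).prod‖ := by
  induction s using Multiset.induction_on with
  | empty => simp
  | cons a s ih =>
    rw [Multiset.map_cons, Multiset.prod_cons, Multiset.map_cons, Multiset.prod_cons,
      Multiset.card_cons, norm_mul, norm_mul]
    have h1 := h a (Multiset.mem_cons_self a s)
    have h2 := ih fun w hw => h w (Multiset.mem_cons_of_mem hw)
    calc ‖f a‖ * ‖(s.map f).prod‖ ≤ (c * ‖g a‖) * (c ^ s.card * ‖(s.map g).prod‖) :=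
          mul_le_mul h1 h2 (norm_nonneg _) (by positivity)
      _ = c ^ (s.card + 1) * (‖g a‖ * ‖(s.map g).prod‖) := by ring

/-- The minors are dominated by any directional derivative along an invariant curve. -/
theorem exists_norm_minor_le {F : Fin 3 → MvPolynomial (Fin 3) ℂ} {H K : MvPolynomial (Fin 3) ℂ}
    {n d : ℕ} (hF : ∀ i, (F i).IsHomogeneous d) (hH : Squarefree H) (hn : H.IsHomogeneous n)
    (hn0 : n ≠ 0) (hinv : ∑ i, F i * MvPolynomial.pderiv i H = K * H)
    (hyp : ∀ v : Fin 3 → ℂ, v ≠ 0 → (∃ μ : ℂ, ∀ i, MvPolynomial.eval v (F i) = μ * v i) →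
      IsHyperbolicVector F v) (a : Fin 3 → ℂ) :
    ∃ C : ℝ, 0 ≤ C ∧ ∀ v : Fin 3 → ℂ, v ≠ 0 → MvPolynomial.eval v H = 0 →
      MvPolynomial.eval v (∑ i, MvPolynomial.C (a i) * MvPolynomial.pderiv i H) ≠ 0 →
      ‖v‖ ^ (n - 1) * ‖MvPolynomial.eval v (∑ i, MvPolynomial.C (a i) * minorPoly F i)‖ ≤
        C * (‖v‖ ^ (1 + d) *
          ‖MvPolynomial.eval v (∑ i, MvPolynomial.C (a i) * MvPolynomial.pderiv i H)‖) := by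
  have hk := fun k => exists_norm_le_gradient hH hn hn0 hinv (minorPoly_isHomogeneous hF k)
    fun v hv h => ⟨hyp v hv h, eval_minorPoly_eq_zero h k⟩
  choose C hC0 hC using hk
  refine ⟨∑ k, C k, Finset.sum_nonneg fun k _ => hC0 k, fun v hv hHv hD => ?_⟩
  -- On the curve `(a·P)/(a·∇H)` equals `P_j/∂_j H` for any `j` with `∂_j H ≠ 0`. Taking the largest
  -- partial derivative makes its norm comparable to that of the whole gradient.
  obtain ⟨j, hj⟩ := Finite.exists_max fun k => ‖MvPolynomial.eval v (MvPolynomial.pderiv k H)‖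
  set D := MvPolynomial.eval v (∑ i, MvPolynomial.C (a i) * MvPolynomial.pderiv i H) with hDdef
  have hj0 : 0 < ‖MvPolynomial.eval v (MvPolynomial.pderiv j H)‖ := by
    rw [norm_pos_iff]
    intro h0
    apply hD
    rw [hDdef, map_sum]
    refine Finset.sum_eq_zero fun k _ => ?_
    have := hj k
    rw [h0, norm_zero] at this
    rw [map_mul, norm_le_zero_iff.1 this, mul_zero]
  have hnorm : ‖fun k : Fin 3 => MvPolynomial.eval v (MvPolynomial.pderiv k H)‖ ≤
      ‖MvPolynomial.eval v (MvPolynomial.pderiv j H)‖ :=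
    (pi_norm_le_iff_of_nonneg (norm_nonneg _)).2 hj
  have hcross : MvPolynomial.eval v (∑ i, MvPolynomial.C (a i) * minorPoly F i) *
      MvPolynomial.eval v (MvPolynomial.pderiv j H) =
      MvPolynomial.eval v (minorPoly F j) * D := by
    have h : ∀ i, MvPolynomial.eval v (minorPoly F i) * MvPolynomial.eval v (MvPolynomial.pderiv j H)
        = MvPolynomial.eval v (minorPoly F j) * MvPolynomial.eval v (MvPolynomial.pderiv i H) := by
      intro i
      obtain ⟨q, hq⟩ := minorPoly_mul_pderiv hn hinv i j
      have h1 := congrArg (MvPolynomial.eval v) hq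
      rw [map_sub, map_mul, map_mul, map_mul, hHv, zero_mul] at h1
      exact sub_eq_zero.1 h1
    simp only [hDdef, map_sum, map_mul, MvPolynomial.eval_C, Finset.sum_mul, Finset.mul_sum]
    refine Finset.sum_congr rfl fun i _ => ?_
    linear_combination a i * h i
  have h1 := hC j v hv
  have h2 := congrArg norm hcross
  rw [norm_mul, norm_mul] at h2
  refine le_of_mul_le_mul_right ?_ hj0
  have h3 : C j ≤ ∑ k, C k := Finset.single_le_sum (fun k _ => hC0 k) (Finset.mem_univ j)
  calc ‖v‖ ^ (n - 1) * ‖MvPolynomial.eval v (∑ i, MvPolynomial.C (a i) * minorPoly F i)‖ *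
        ‖MvPolynomial.eval v (MvPolynomial.pderiv j H)‖
      = ‖v‖ ^ (n - 1) * ‖MvPolynomial.eval v (minorPoly F j)‖ * ‖D‖ := by
        rw [mul_assoc, h2, mul_assoc]
    _ ≤ C j * (‖v‖ ^ (1 + d) * ‖fun k : Fin 3 => MvPolynomial.eval v (MvPolynomial.pderiv k H)‖)
          * ‖D‖ := mul_le_mul_of_nonneg_right h1 (norm_nonneg _)
    _ ≤ (∑ k, C k) * (‖v‖ ^ (1 + d) * ‖MvPolynomial.eval v (MvPolynomial.pderiv j H)‖) * ‖D‖ := by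
        gcongr
        exact Finset.sum_nonneg fun k _ => hC0 k
    _ = _ := by ring

/-- With degree `d + 3 + q` the powers of the norm `r` differ by `q + 1`. As `r` is bounded below by
`s / κ`, the `q` surplus powers go into the constant; the remaining one dominates `x`. -/
theorem mul_le_of_weighted_bound {κ s r x T D A C : ℝ} {q d : ℕ} (hs : 0 < s)
    (hr : 0 < r) (hT : 0 ≤ T) (hA : 0 ≤ A) (hsr : s ≤ κ * r) (hx : x ≤ A * r)
    (hb : r ^ (d + 3 + q - 1) * T ≤ C * (r ^ (1 + d) * D)) :
    x * T ≤ A * ((κ / s) ^ q * C) * D := by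
  have h1 : 1 ≤ (κ / s) * r := by
    rwa [div_mul_eq_mul_div, le_div_iff₀ hs, one_mul]
  have h0 : 0 ≤ κ / s := by
    by_contra! h
    nlinarith
  have hone : 1 ≤ (κ / s) ^ q * r ^ q := by
    rw [← mul_pow]
    exact one_le_pow₀ h1
  have hb' : r ^ q * (r * T) ≤ C * D := by
    have hp : 0 < r ^ (1 + d) := by positivity
    refine le_of_mul_le_mul_left ?_ hp
    calc r ^ (1 + d) * (r ^ q * (r * T)) = r ^ (d + 3 + q - 1) * T := by
          rw [show d + 3 + q - 1 = (1 + d) + q + 1 by omega]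
          ring
      _ ≤ C * (r ^ (1 + d) * D) := hb
      _ = _ := by ring
  have hrT : r * T ≤ (κ / s) ^ q * C * D := by
    calc r * T ≤ ((κ / s) ^ q * r ^ q) * (r * T) := le_mul_of_one_le_left (by positivity) hone
      _ = (κ / s) ^ q * (r ^ q * (r * T)) := by ring
      _ ≤ (κ / s) ^ q * (C * D) := mul_le_mul_of_nonneg_left hb' (by positivity)
      _ = _ := by ring
  calc x * T ≤ (A * r) * T := mul_le_mul_of_nonneg_right hx hT
    _ = A * (r * T) := by ring
    _ ≤ A * ((κ / s) ^ q * C * D) := mul_le_mul_of_nonneg_left hrT hA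
    _ = _ := by ring

/-- The previous bound, when the degree is large. -/
theorem exists_norm_minor_le_of_lt {F : Fin 3 → MvPolynomial (Fin 3) ℂ}
    {H K : MvPolynomial (Fin 3) ℂ}
    {n d : ℕ} (hF : ∀ i, (F i).IsHomogeneous d) (hH : Squarefree H) (hn : H.IsHomogeneous n)
    (hnd : d + 2 < n) (hinv : ∑ i, F i * MvPolynomial.pderiv i H = K * H)
    (hyp : ∀ v : Fin 3 → ℂ, v ≠ 0 → (∃ μ : ℂ, ∀ i, MvPolynomial.eval v (F i) = μ * v i) →
      IsHyperbolicVector F v) (a : Fin 3 → ℂ) {M : Matrix (Fin 3) (Fin 3) ℂ}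
    (hM : IsUnit M.det) {s t : ℂ} (hs : s ≠ 0) :
    ∃ C : ℝ, 0 ≤ C ∧ ∀ (x w : ℂ) (v : Fin 3 → ℂ), v = Matrix.vecMul ![w, s, t + x] M →
      MvPolynomial.eval v H = 0 →
      MvPolynomial.eval v (∑ i, MvPolynomial.C (a i) * MvPolynomial.pderiv i H) ≠ 0 →
      (1 + ‖x‖) * ‖MvPolynomial.eval v (∑ i, MvPolynomial.C (a i) * minorPoly F i)‖ ≤
        C * ‖MvPolynomial.eval v (∑ i, MvPolynomial.C (a i) * MvPolynomial.pderiv i H)‖ := by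
  obtain ⟨C, hC0, hC⟩ := exists_norm_minor_le hF hH hn (by omega) hinv hyp a
  obtain ⟨q, rfl⟩ : ∃ q, n = d + 3 + q := ⟨n - (d + 3), by omega⟩
  -- The norm of the inverse coordinate change, increased by one to be positive, bounds the frame
  -- coordinates by `‖v‖`.
  set κ : ℝ := ‖(Matrix.vecMulLinear M⁻¹).toContinuousLinearMap‖ + 1 with hκ
  have hκ0 : 0 < κ := by positivity
  have hs0 : 0 < ‖s‖ := norm_pos_iff.2 hs
  refine ⟨κ * ((1 + ‖t‖) / ‖s‖ + 1) * ((κ / ‖s‖) ^ q * C), by positivity,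
    fun x w v hv hHv hD => ?_⟩
  have hback : ‖(![w, s, t + x] : Fin 3 → ℂ)‖ ≤ κ * ‖v‖ := by
    have h1 := (Matrix.vecMulLinear M⁻¹).toContinuousLinearMap.le_opNorm v
    have h2 : (Matrix.vecMulLinear M⁻¹).toContinuousLinearMap v = ![w, s, t + x] := by
      simp [hv, Matrix.vecMul_vecMul, Matrix.mul_nonsing_inv M hM]
    rw [h2] at h1
    refine h1.trans (mul_le_mul_of_nonneg_right ?_ (norm_nonneg _))
    rw [hκ]
    linarith
  have hsv : ‖s‖ ≤ κ * ‖v‖ := (norm_le_pi_norm ![w, s, t + x] 1).trans hback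
  have htv : ‖t + x‖ ≤ κ * ‖v‖ := (norm_le_pi_norm ![w, s, t + x] 2).trans hback
  have hvpos : 0 < ‖v‖ := by
    by_contra h
    have : ‖v‖ = 0 := le_antisymm (not_lt.1 h) (norm_nonneg _)
    rw [this, mul_zero] at hsv
    linarith
  have hx : 1 + ‖x‖ ≤ κ * ((1 + ‖t‖) / ‖s‖ + 1) * ‖v‖ := by
    have h1 : ‖x‖ ≤ ‖t + x‖ + ‖t‖ := by
      have := norm_sub_le (t + x) t
      rwa [add_sub_cancel_left] at this
    have h2 : 1 + ‖t‖ ≤ (1 + ‖t‖) / ‖s‖ * (κ * ‖v‖) := by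
      rw [div_mul_eq_mul_div, le_div_iff₀ hs0]
      exact mul_le_mul_of_nonneg_left hsv (by positivity)
    nlinarith
  exact mul_le_of_weighted_bound hs0 hvpos (norm_nonneg _) (by positivity) hsv hx
    (hC v (norm_pos_iff.1 hvpos) hHv hD)

/-- A reduced invariant curve of a foliation of degree `d` with hyperbolic singularities has degree
at most `d + 2`. -/
theorem degree_le_of_invariant {F : Fin 3 → MvPolynomial (Fin 3) ℂ} {H K : MvPolynomial (Fin 3) ℂ}
    {n d : ℕ} (hF : ∀ i, (F i).IsHomogeneous d) (hH : Squarefree H) (hn : H.IsHomogeneous n)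
    (hinv : ∑ i, F i * MvPolynomial.pderiv i H = K * H)
    (hyp : ∀ v : Fin 3 → ℂ, v ≠ 0 → (∃ μ : ℂ, ∀ i, MvPolynomial.eval v (F i) = μ * v i) →
      IsHyperbolicVector F v) : n ≤ d + 2 := by
  by_contra! hnd
  have hH0 : H ≠ 0 := hH.ne_zero
  obtain ⟨a, haH⟩ : ∃ a, MvPolynomial.eval a H ≠ 0 := by
    by_contra! hcon
    exact hH0 (MvPolynomial.funext fun x => by rw [hcon x, map_zero])
  have hzero : MvPolynomial.eval (0 : Fin 3 → ℂ) H = 0 := by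
    have h := eval_smul_of_isHomogeneous hn 0 a
    rwa [zero_smul, zero_pow (by omega), zero_mul] at h
  have ha0 : a ≠ 0 := by
    rintro rfl
    exact haH hzero
  obtain ⟨b, c, hM⟩ := exists_frame ha0
  set M := Matrix.of ![a, b, c] with hMdef
  have hrow : ∀ i, M 0 i = a i := fun i => by simp [hMdef]
  set e := MvPolynomial.finSuccEquiv ℂ 2 with he
  set Da := ∑ i, MvPolynomial.C (a i) * MvPolynomial.pderiv i H with hDa
  set T := ∑ i, MvPolynomial.C (a i) * minorPoly F i with hT
  set p := e (linSubst M H) with hp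
  set t := e (linSubst M T) with ht
  have hp' : Polynomial.derivative p = e (linSubst M Da) := by
    rw [hp, he, derivative_finSuccEquiv, pderiv_linSubst]
    simp only [hrow, hDa]
  have hev : ∀ (q : MvPolynomial (Fin 3) ℂ) (w : ℂ) (z : Fin 2 → ℂ),
      Polynomial.eval w ((e (linSubst M q)).map (MvPolynomial.eval z))
        = MvPolynomial.eval (Matrix.vecMul ![w, z 0, z 1] M) q := by
    intro q w z
    rw [← eval_linSubst, he, ← MvPolynomial.eval_eq_eval_mv_eval']
    congr 2
    ext i
    fin_cases i <;> rfl
  have hsq : Squarefree p := squarefree_mulEquiv e (squarefree_mulEquiv (linSubstEquiv M hM) hH)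
  -- On the line through `0` and `a`, `H` takes the value `0` at the origin and a nonzero value at
  -- `a`. Positive degree is needed so that the product over the roots has at least one decaying
  -- factor.
  have hN : p.natDegree ≠ 0 := by
    intro h0
    have h1 := fun w => hev H w 0
    rw [← hp, Polynomial.eq_C_of_natDegree_eq_zero h0] at h1
    simp only [Polynomial.map_C, Polynomial.eval_C] at h1
    have h2 := (h1 1).symm.trans (h1 0)
    apply haH
    have e1 : Matrix.vecMul ![1, (0 : Fin 2 → ℂ) 0, (0 : Fin 2 → ℂ) 1] M = a := by
      rw [hMdef, vecMul_of_fin_three]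
      simp
    have e0 : Matrix.vecMul ![0, (0 : Fin 2 → ℂ) 0, (0 : Fin 2 → ℂ) 1] M = 0 := by
      rw [hMdef, vecMul_of_fin_three]
      simp
    rwa [e1, e0, hzero] at h2
  obtain ⟨r₁, hr₁, a₁, b₁, hab₁⟩ := exists_combination_eq_C p (Polynomial.derivative p) hsq.ne_zero
    fun f hf hdeg hfp => not_dvd_derivative_of_squarefree hsq hf hdeg hfp
  have hpull : ∀ (f : Polynomial (MvPolynomial (Fin 2) ℂ)) (q : MvPolynomial (Fin 3) ℂ),
      f ∣ e (linSubst M q) → (linSubstEquiv M hM).symm (e.symm f) ∣ q := by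
    intro f q hfq
    have h := map_dvd (linSubstEquiv M hM).symm (map_dvd e.symm hfq)
    rwa [e.symm_apply_apply, ← linSubstEquiv_apply M hM, AlgEquiv.symm_apply_apply] at h
  -- A common factor `f₀` of `H` and `T` divides every `minorPoly F k * Da`. Squarefreeness prevents
  -- it from dividing `Da`, so it divides all the minors, contradicting the isolation of singular
  -- points.
  obtain ⟨r₂, hr₂, a₂, b₂, hab₂⟩ := exists_combination_eq_C p t hsq.ne_zero (by
    intro f hf hdeg hfp hft
    -- A nonvanishing leading coefficient ensures a root of `f` above `z`, and `z 0 ≠ 0` keeps the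
    -- resulting point away from the origin.
    obtain ⟨z, hz⟩ : ∃ z, MvPolynomial.eval z (MvPolynomial.X 0 * f.leadingCoeff) ≠ 0 := by
      by_contra! hcon
      exact mul_ne_zero (MvPolynomial.X_ne_zero (R := ℂ) (0 : Fin 2))
        (Polynomial.leadingCoeff_ne_zero.2 hf.ne_zero)
        (MvPolynomial.funext fun x => by rw [hcon x, map_zero])
    rw [map_mul, MvPolynomial.eval_X] at hz
    have hdegz : (f.map (MvPolynomial.eval z)).natDegree = f.natDegree :=
      Polynomial.natDegree_map_of_leadingCoeff_ne_zero _ (right_ne_zero_of_mul hz)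
    obtain ⟨w, hw⟩ : ∃ w, (f.map (MvPolynomial.eval z)).IsRoot w := by
      apply Complex.exists_root
      rw [← Polynomial.natDegree_pos_iff_degree_pos, hdegz]
      exact hdeg
    set f₀ := (linSubstEquiv M hM).symm (e.symm f) with hf₀
    have hef : e (linSubst M f₀) = f := by
      rw [← linSubstEquiv_apply M hM, hf₀, AlgEquiv.apply_symm_apply, e.apply_symm_apply]
    have hf₀prime : Prime f₀ := by
      have h1 := hf.prime
      rw [← hef, ← linSubstEquiv_apply M hM] at h1
      exact (MulEquiv.prime_iff (linSubstEquiv M hM)).1 ((MulEquiv.prime_iff e).1 h1)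
    have hnDa : ¬ f₀ ∣ Da := by
      intro hcon
      have h1 := map_dvd e (map_dvd (linSubstEquiv M hM) hcon)
      rw [linSubstEquiv_apply, linSubstEquiv_apply, hef, ← hp'] at h1
      exact not_dvd_derivative_of_squarefree hsq hf hdeg hfp h1
    have hfH : f₀ ∣ H := hpull f H hfp
    have hfT : f₀ ∣ T := hpull f T hft
    refine not_forall_dvd_minorPoly hyp (f := f₀) (v := Matrix.vecMul ![w, z 0, z 1] M) ?_ ?_ ?_
    · intro h0
      have h1 : Matrix.vecMul ![w, z 0, z 1] M = Matrix.vecMul 0 M := by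
        rw [h0, Matrix.zero_vecMul]
      have h2 := Matrix.vecMul_injective_of_isUnit ((Matrix.isUnit_iff_isUnit_det _).2 hM) h1
      exact left_ne_zero_of_mul hz (by simpa using congrFun h2 1)
    · rw [← hev, hef]
      exact hw
    · intro k
      have h1 : f₀ ∣ minorPoly F k * Da := by
        have h2 : minorPoly F k * Da = T * MvPolynomial.pderiv k H -
            ∑ i, MvPolynomial.C (a i) * (minorPoly F i * MvPolynomial.pderiv k H
              - minorPoly F k * MvPolynomial.pderiv i H) := by
          rw [eq_sub_iff_add_eq, hDa, hT, Finset.mul_sum, Finset.sum_mul,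
            ← Finset.sum_add_distrib]
          refine Finset.sum_congr rfl fun i _ => ?_
          ring
        rw [h2]
        refine dvd_sub (hfT.mul_right _) (Finset.dvd_sum fun i _ => Dvd.dvd.mul_left ?_ _)
        exact hfH.trans (minorPoly_mul_pderiv hn hinv i k)
      exact (hf₀prime.dvd_or_dvd h1).resolve_right hnDa)
  set lc := p.leadingCoeff with hlc
  have hlc0 : lc ≠ 0 := Polynomial.leadingCoeff_ne_zero.2 hsq.ne_zero
  obtain ⟨z, hz⟩ : ∃ z, MvPolynomial.eval z (MvPolynomial.X 0 * (r₁ * r₂ * lc)) ≠ 0 := by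
    by_contra! hcon
    exact mul_ne_zero (MvPolynomial.X_ne_zero (R := ℂ) (0 : Fin 2))
      (mul_ne_zero (mul_ne_zero hr₁ hr₂) hlc0)
      (MvPolynomial.funext fun x => by rw [hcon x, map_zero])
  simp only [map_mul, MvPolynomial.eval_X] at hz
  have hz0 : z 0 ≠ 0 := left_ne_zero_of_mul hz
  have hzl : MvPolynomial.eval z lc ≠ 0 := right_ne_zero_of_mul (right_ne_zero_of_mul hz)
  have hzr := left_ne_zero_of_mul (right_ne_zero_of_mul hz)
  obtain ⟨C, hC0, hC⟩ := exists_norm_minor_le_of_lt hF hH hn hnd hinv hyp a hM (s := z 0)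
    (t := z 1) hz0
  -- A common formal degree gives both resultants the same power of the leading coefficient, which
  -- drops out of the comparison.
  set m := max p.natDegree t.natDegree with hm
  set R₁ := p.resultant (Polynomial.derivative p) p.natDegree m with hR₁
  set R₂ := p.resultant t p.natDegree m with hR₂
  have hres : ∀ (y : Fin 2 → ℂ) (q : Polynomial (MvPolynomial (Fin 2) ℂ)), q.natDegree ≤ m →
      MvPolynomial.eval y lc ≠ 0 →
      MvPolynomial.eval y (p.resultant q p.natDegree m) = MvPolynomial.eval y lc ^ m *
        ((p.map (MvPolynomial.eval y)).roots.map
          fun w => (q.map (MvPolynomial.eval y)).eval w).prod := by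
    intro y q hq hy
    have hdeg : (p.map (MvPolynomial.eval y)).natDegree = p.natDegree :=
      Polynomial.natDegree_map_of_leadingCoeff_ne_zero _ hy
    rw [← Polynomial.resultant_map_map, ← hdeg,
      Polynomial.resultant_eq_prod_eval _ _ _ (Polynomial.natDegree_map_le.trans hq)
        (IsAlgClosed.splits _), Polynomial.leadingCoeff_map_of_leadingCoeff_ne_zero _ hy]
  have hd1 : (Polynomial.derivative p).natDegree ≤ m :=
    (Polynomial.natDegree_derivative_le p).trans ((Nat.sub_le _ _).trans (le_max_left _ _))
  have hd2 : t.natDegree ≤ m := le_max_right _ _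
  have hnz : ∀ (q a' b' : Polynomial (MvPolynomial (Fin 2) ℂ)) (r : MvPolynomial (Fin 2) ℂ),
      q.natDegree ≤ m → a' * p + b' * q = Polynomial.C r → MvPolynomial.eval z r ≠ 0 →
      MvPolynomial.eval z (p.resultant q p.natDegree m) ≠ 0 := by
    intro q a' b' r hq hab hr
    rw [hres z q hq hzl]
    refine mul_ne_zero (pow_ne_zero _ hzl) ?_
    refine Multiset.prod_ne_zero fun hmem => hr ?_
    obtain ⟨w, hw, h0⟩ := Multiset.mem_map.1 hmem
    have h1 := congrArg (fun f => (f.map (MvPolynomial.eval z)).eval w) hab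
    have h2 := (Polynomial.isRoot_of_mem_roots hw).eq_zero
    simpa [h0, h2] using h1.symm
  -- Restriction of the coefficients to the line `x ↦ (z 0, z 1 + x)`.
  set φ : MvPolynomial (Fin 2) ℂ →ₐ[ℂ] Polynomial ℂ :=
    MvPolynomial.aeval ![Polynomial.C (z 0), Polynomial.C (z 1) + Polynomial.X] with hφ
  have hφev : ∀ (x : ℂ) (r : MvPolynomial (Fin 2) ℂ),
      (φ r).eval x = MvPolynomial.eval ![z 0, z 1 + x] r := by
    intro x r
    have h1 : (Polynomial.aeval x).comp φ = MvPolynomial.aeval ![z 0, z 1 + x] := by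
      apply MvPolynomial.algHom_ext
      intro l
      fin_cases l <;> simp [hφ]
    have h2 := DFunLike.congr_fun h1 r
    rwa [AlgHom.comp_apply, MvPolynomial.aeval_eq_eval, Polynomial.coe_aeval_eq_eval] at h2
  have hφ0 : ∀ r, (φ r).eval 0 = MvPolynomial.eval z r := by
    intro r
    rw [hφev]
    congr 2
    ext i
    fin_cases i <;> simp
  have hQ : φ (R₁ * lc) ≠ 0 := by
    intro h0
    have h1 := hφ0 (R₁ * lc)
    rw [h0, Polynomial.eval_zero, map_mul] at h1
    exact mul_ne_zero (hnz _ a₁ b₁ r₁ hd1 hab₁ (left_ne_zero_of_mul hzr)) hzl h1.symm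
  -- `R₂ / R₁` is the product, over the roots `w`, of the quotients of `T` by `Da`, each at most `C
  -- / (1 + ‖x‖)`. The factor `lc` puts the values of `x` where the degree of `p` drops among the
  -- exceptional ones.
  have hP : φ (R₂ * lc) = 0 := by
    refine eq_zero_of_norm_mul_le _ _ (φ (R₁ * lc)) (C ^ p.natDegree) rfl hQ fun x hx => ?_
    rw [hφev, map_mul] at hx
    have hlx := right_ne_zero_of_mul hx
    set y : Fin 2 → ℂ := ![z 0, z 1 + x] with hy
    rw [hφev, hφev, map_mul, map_mul, norm_mul, norm_mul, ← mul_assoc, ← mul_assoc]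
    refine mul_le_mul_of_nonneg_right ?_ (norm_nonneg _)
    have hx1 := left_ne_zero_of_mul hx
    rw [hR₁, hres y _ hd1 hlx] at hx1 ⊢
    rw [hR₂, hres y _ hd2 hlx, norm_mul, norm_mul]
    have hx2 := right_ne_zero_of_mul hx1
    have hcard : (p.map (MvPolynomial.eval y)).roots.card = p.natDegree := by
      rw [← Polynomial.natDegree_map_of_leadingCoeff_ne_zero (MvPolynomial.eval y) hlx]
      exact (IsAlgClosed.splits _).natDegree_eq_card_roots.symm
    have hpos : 0 < 1 + ‖x‖ := by positivity
    have hprod := norm_prod_map_le_of_forall (c := C / (1 + ‖x‖)) (by positivity)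
      (p.map (MvPolynomial.eval y)).roots (f := fun w => (t.map (MvPolynomial.eval y)).eval w)
      (g := fun w => ((Polynomial.derivative p).map (MvPolynomial.eval y)).eval w) (by
        intro w hw
        have hw0 := Polynomial.isRoot_of_mem_roots hw
        rw [Polynomial.IsRoot, hp, hev] at hw0
        rw [div_mul_eq_mul_div, le_div_iff₀ hpos, mul_comm]
        have hder : ((Polynomial.derivative p).map (MvPolynomial.eval y)).eval w ≠ 0 := by
          intro h0
          apply hx2
          exact Multiset.prod_eq_zero (Multiset.mem_map.2 ⟨w, hw, h0⟩)
        rw [hp', hev] at hder ⊢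
        rw [hev]
        exact hC x w _ rfl hw0 hder)
    rw [hcard] at hprod
    have hpow : (1 + ‖x‖) * (C / (1 + ‖x‖)) ^ p.natDegree ≤ C ^ p.natDegree := by
      rw [div_pow, mul_div_assoc', div_le_iff₀ (by positivity), mul_comm]
      exact mul_le_mul_of_nonneg_left (le_self_pow₀ (by linarith [norm_nonneg x]) hN)
        (by positivity)
    have hl := norm_nonneg (MvPolynomial.eval y lc ^ m)
    set A := ‖((p.map (MvPolynomial.eval y)).roots.map
          fun w => (t.map (MvPolynomial.eval y)).eval w).prod‖
    set B := ‖((p.map (MvPolynomial.eval y)).roots.map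
          fun w => ((Polynomial.derivative p).map (MvPolynomial.eval y)).eval w).prod‖
    have hB : 0 ≤ B := norm_nonneg _
    have h1 : (1 + ‖x‖) * A ≤ C ^ p.natDegree * B :=
      calc (1 + ‖x‖) * A ≤ (1 + ‖x‖) * ((C / (1 + ‖x‖)) ^ p.natDegree * B) :=
            mul_le_mul_of_nonneg_left hprod hpos.le
        _ = ((1 + ‖x‖) * (C / (1 + ‖x‖)) ^ p.natDegree) * B := by ring
        _ ≤ _ := mul_le_mul_of_nonneg_right hpow hB
    calc (1 + ‖x‖) * (‖MvPolynomial.eval y lc ^ m‖ * A)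
        = ‖MvPolynomial.eval y lc ^ m‖ * ((1 + ‖x‖) * A) := by ring
      _ ≤ ‖MvPolynomial.eval y lc ^ m‖ * (C ^ p.natDegree * B) :=
          mul_le_mul_of_nonneg_left h1 hl
      _ = _ := by ring
  have h1 := hφ0 (R₂ * lc)
  rw [hP, Polynomial.eval_zero, map_mul] at h1
  exact mul_ne_zero (hnz _ a₂ b₂ r₂ hd2 hab₂ (right_ne_zero_of_mul hzr)) hzl h1.symm

/-! ### From invariant sets of points to equations -/

theorem field_gradient_isHomogeneous {F : Fin 3 → MvPolynomial (Fin 3) ℂ}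
    {h : MvPolynomial (Fin 3) ℂ} {d n : ℕ} (hF : ∀ i, (F i).IsHomogeneous d)
    (hn : h.IsHomogeneous n) :
    (∑ i, F i * MvPolynomial.pderiv i h).IsHomogeneous (d + (n - 1)) :=
  MvPolynomial.IsHomogeneous.sum _ _ _ fun i _ => (hF i).mul hn.pderiv

/-- The Nullstellensatz for the prime ideal `(h)` also tests the origin, where nothing is assumed
about `g`. It is therefore applied to the products `X i * g`; an irreducible `h` cannot divide two
different variables. -/
theorem dvd_of_forall_eval_eq_zero {h g : MvPolynomial (Fin 3) ℂ} (hh : Irreducible h)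
    (hg : ∀ v : Fin 3 → ℂ, v ≠ 0 → MvPolynomial.eval v h = 0 → MvPolynomial.eval v g = 0) :
    h ∣ g := by
  have hp : (Ideal.span {h}).IsPrime :=
    (Ideal.span_singleton_prime hh.ne_zero).2 hh.prime
  have key : ∀ i : Fin 3, h ∣ MvPolynomial.X i * g := by
    intro i
    rw [← Ideal.mem_span_singleton,
      ← MvPolynomial.IsPrime.vanishingIdeal_zeroLocus (K := ℂ) (Ideal.span {h})]
    rw [MvPolynomial.mem_vanishingIdeal_iff]
    intro v hv
    rw [MvPolynomial.zeroLocus_span] at hv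
    have hv' : MvPolynomial.eval v h = 0 := by
      simpa [MvPolynomial.aeval_eq_eval] using hv
    rw [MvPolynomial.aeval_eq_eval]
    change MvPolynomial.eval v (MvPolynomial.X i * g) = 0
    rw [map_mul, MvPolynomial.eval_X]
    by_cases h0 : v = 0
    · rw [h0, Pi.zero_apply, zero_mul]
    · rw [hg v h0 hv', mul_zero]
  by_contra hcon
  have h0 := (hh.prime.dvd_or_dvd (key 0)).resolve_right hcon
  have h1 := (hh.prime.dvd_or_dvd (key 1)).resolve_right hcon
  have hX : Prime (MvPolynomial.X 0 : MvPolynomial (Fin 3) ℂ) := by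
    rw [← MulEquiv.prime_iff (MvPolynomial.finSuccEquiv ℂ 2), MvPolynomial.finSuccEquiv_X_zero]
    exact Polynomial.prime_X
  have hass := (hh.dvd_irreducible_iff_associated hX.irreducible).1 h0
  have h2 := hass.symm.dvd.trans h1
  rw [MvPolynomial.X_dvd_X] at h2
  simp at h2

theorem mem_mk_submodule {v x : Fin 3 → ℂ} (hv : v ≠ 0) :
    x ∈ (Projectivization.mk ℂ v hv).submodule ↔ ∃ a : ℂ, a • v = x := by
  rw [Projectivization.submodule_mk, Submodule.mem_span_singleton]

theorem mk_mem_projZeroLocus {h : MvPolynomial (Fin 3) ℂ} {n : ℕ} (hn : h.IsHomogeneous n)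
    {v : Fin 3 → ℂ} (hv : v ≠ 0) :
    Projectivization.mk ℂ v hv ∈ projZeroLocus h ↔ MvPolynomial.eval v h = 0 := by
  constructor
  · intro hmem
    exact hmem v ((mem_mk_submodule hv).2 ⟨1, one_smul _ _⟩)
  · intro h0 x hx
    obtain ⟨a, rfl⟩ := (mem_mk_submodule hv).1 hx
    rw [eval_smul_of_isHomogeneous hn, h0, mul_zero]

theorem isHomogeneous_ne_zero_of_irreducible {h : MvPolynomial (Fin 3) ℂ} {n : ℕ}
    (hn : h.IsHomogeneous n) (hh : Irreducible h) : n ≠ 0 := by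
  rintro rfl
  rw [← MvPolynomial.totalDegree_zero_iff_isHomogeneous,
    MvPolynomial.totalDegree_eq_zero_iff_eq_C] at hn
  apply hh.not_isUnit
  rw [hn]
  refine (isUnit_iff_ne_zero.2 fun h0 => hh.ne_zero ?_).map MvPolynomial.C
  rw [hn, h0, map_zero]

namespace PlaneFoliation

variable {d : ℕ} (F : PlaneFoliation d)

/-- The last plaque of a chain works: any of its points ends a chain with the same earlier plaques.
-/
theorem exists_plaque_of_mem_leaf {p₀ p : P2} (hp : p ∈ F.leaf p₀) :
    ∃ S, F.IsPlaque S ∧ p ∈ S ∧ S ⊆ F.leaf p₀ := by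
  rcases Relation.TransGen.tail'_iff.1 hp with ⟨b, hb, S, hS, hbS, hpS⟩
  exact ⟨S, hS, hpS, fun q hq => Relation.TransGen.tail'_iff.2 ⟨b, hb, S, hS, hbS, hq⟩⟩

/-- The equation of an invariant curve divides its derivative along the vector field. -/
theorem dvd_field_gradient {h : MvPolynomial (Fin 3) ℂ} {n : ℕ} (hn : h.IsHomogeneous n)
    (hh : Irreducible h) (hinv : F.IsInvariant (projZeroLocus h)) :
    h ∣ ∑ i, F.comp i * MvPolynomial.pderiv i h := by
  refine dvd_of_forall_eval_eq_zero hh fun v hv hvh => ?_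
  set p := Projectivization.mk ℂ v hv with hp
  have hpC : p ∈ projZeroLocus h := (mk_mem_projZeroLocus hn hv).2 hvh
  -- At a singular point `F(v) = a v`, and Euler's relation suffices. Elsewhere a trajectory through
  -- a multiple of `v` stays in the zero set, and `h` is differentiated along it.
  by_cases hsing : p ∈ F.Sing
  · obtain ⟨a, ha⟩ := (mem_mk_submodule hv).1
      (hsing v ((mem_mk_submodule hv).2 ⟨1, one_smul _ _⟩))
    have hE := congrArg (MvPolynomial.eval v) hn.sum_X_mul_pderiv
    rw [nsmul_eq_mul, map_mul, hvh, mul_zero, map_sum] at hE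
    rw [map_sum]
    have h1 : ∀ i, MvPolynomial.eval v (F.comp i * MvPolynomial.pderiv i h) =
        a * MvPolynomial.eval v (MvPolynomial.X i * MvPolynomial.pderiv i h) := by
      intro i
      have h2 := congrFun ha i
      simp only [Pi.smul_apply, smul_eq_mul, field] at h2
      rw [map_mul, map_mul, ← h2, MvPolynomial.eval_X, mul_assoc]
    simp only [h1, ← Finset.mul_sum, hE, mul_zero]
  · obtain ⟨T, hT⟩ := hinv
    have hmem : p ∈ projZeroLocus h \ F.Sing := ⟨hpC, hsing⟩
    rw [hT] at hmem
    obtain ⟨p₀, hp₀, hpl⟩ := Set.mem_iUnion₂.1 hmem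
    obtain ⟨S, ⟨r, z, hr, hz, rfl, hdisj⟩, ⟨t₀, ht₀, hzt₀⟩, hSl⟩ := F.exists_plaque_of_mem_leaf hpl
    have hvan : ∀ t ∈ Metric.ball (0 : ℂ) r, MvPolynomial.eval (z t) h = 0 := by
      intro t ht
      have hq : Projectivization.mk ℂ (z t) (hz t ht).1 ∈ projZeroLocus h \ F.Sing := by
        rw [hT]
        refine Set.mem_iUnion₂.2 ⟨p₀, hp₀, hSl ⟨t, ht, ?_⟩⟩
        exact (mem_mk_submodule _).2 ⟨1, one_smul _ _⟩
      exact (mk_mem_projZeroLocus hn _).1 hq.1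
    have hder := (hasFDerivAt_eval h (z t₀)).comp_hasDerivAt t₀ (hz t₀ ht₀).2
    have hzero : HasDerivAt ((fun w => MvPolynomial.eval w h) ∘ z) 0 t₀ := by
      refine (hasDerivAt_const t₀ (0 : ℂ)).congr_of_eventuallyEq ?_
      filter_upwards [Metric.isOpen_ball.mem_nhds ht₀] with t ht using hvan t ht
    have heq := hder.unique hzero
    obtain ⟨c, hc⟩ := (mem_mk_submodule hv).1 hzt₀
    have hc0 : c ≠ 0 := by
      rintro rfl
      exact (hz t₀ ht₀).1 (by rw [← hc, zero_smul])
    have h1 : MvPolynomial.eval (z t₀) (∑ i, F.comp i * MvPolynomial.pderiv i h) = 0 := by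
      rw [← heq]
      simp [field, mul_comm]
    rw [← hc, eval_smul_of_isHomogeneous (field_gradient_isHomogeneous F.homogeneous hn)] at h1
    exact (mul_eq_zero.1 h1).resolve_left (pow_ne_zero _ hc0)

end PlaneFoliation

theorem prod_dvd_derivation_prod {ι A : Type*} [CommRing A] [Algebra ℂ A] (D : Derivation ℂ A A)
    (s : Finset ι) (f : ι → A) (h : ∀ i ∈ s, f i ∣ D (f i)) :
    ∏ i ∈ s, f i ∣ D (∏ i ∈ s, f i) := by
  induction s using Finset.cons_induction with
  | empty => simp
  | cons a s ha ih =>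
    rw [Finset.prod_cons, Derivation.leibniz, smul_eq_mul, smul_eq_mul]
    refine dvd_add (mul_dvd_mul_left _ (ih fun i hi => h i (Finset.mem_cons_of_mem hi))) ?_
    rw [mul_comm (f a)]
    exact mul_dvd_mul_left _ (h a (Finset.mem_cons_self a s))

/-! ### Hyperbolicity: from charts to homogeneous coordinates -/

namespace PlaneFoliation

variable {d : ℕ} (F : PlaneFoliation d)

/-- The polynomials that define the inclusion of an affine chart. -/
noncomputable def chartPoly (i : Fin 3) : Fin 3 → MvPolynomial (Fin 2) ℂ :=
  Fin.insertNth (α := fun _ => MvPolynomial (Fin 2) ℂ) i 1 MvPolynomial.X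

theorem eval_aeval_chartPoly (i : Fin 3) (w : Fin 2 → ℂ) (p : MvPolynomial (Fin 3) ℂ) :
    MvPolynomial.eval w (MvPolynomial.aeval (chartPoly i) p) =
      MvPolynomial.eval (chartPoint i w) p := by
  have h : (MvPolynomial.aeval w).comp (MvPolynomial.aeval (chartPoly i))
      = MvPolynomial.aeval (chartPoint i w) := by
    apply MvPolynomial.algHom_ext
    intro l
    rcases Fin.eq_self_or_eq_succAbove i l with rfl | ⟨k, rfl⟩ <;> simp [chartPoly, chartPoint]
  have h1 := DFunLike.congr_fun h p
  rwa [AlgHom.comp_apply, MvPolynomial.aeval_eq_eval, MvPolynomial.aeval_eq_eval] at h1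

theorem sum_pderiv_chartPoly (i : Fin 3) (w f : Fin 2 → ℂ) (p : MvPolynomial (Fin 3) ℂ) :
    ∑ l, MvPolynomial.eval w (MvPolynomial.pderiv l (MvPolynomial.aeval (chartPoly i) p)) * f l =
      ∑ j, Fin.insertNth (α := fun _ => ℂ) i 0 f j *
        MvPolynomial.eval (chartPoint i w) (MvPolynomial.pderiv j p) := by
  have h : ∀ l, MvPolynomial.eval w
      (MvPolynomial.pderiv l (MvPolynomial.aeval (chartPoly i) p)) =
      MvPolynomial.eval (chartPoint i w) (MvPolynomial.pderiv (i.succAbove l) p) := by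
    intro l
    rw [derivation_aeval, Fin.sum_univ_succAbove _ i, ← eval_aeval_chartPoly]
    simp [chartPoly, MvPolynomial.pderiv_X, Pi.single_apply]
  rw [Fin.sum_univ_succAbove _ i]
  simp only [h, Fin.insertNth_apply_same, Fin.insertNth_apply_succAbove, zero_mul, zero_add]
  exact Finset.sum_congr rfl fun l _ => mul_comm _ _

theorem fderiv_chartField (i : Fin 3) (w f : Fin 2 → ℂ) (k : Fin 2) :
    fderiv ℂ (F.chartField i) w f k =
      ∑ j, Fin.insertNth (α := fun _ => ℂ) i 0 f j * MvPolynomial.eval (chartPoint i w)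
          (MvPolynomial.pderiv j (F.comp (i.succAbove k)))
        - f k * MvPolynomial.eval (chartPoint i w) (F.comp i)
        - w k * ∑ j, Fin.insertNth (α := fun _ => ℂ) i 0 f j * MvPolynomial.eval (chartPoint i w)
          (MvPolynomial.pderiv j (F.comp i)) := by
  have hfield : ∀ k, (fun w => F.chartField i w k) = fun w => MvPolynomial.eval w
      (MvPolynomial.aeval (chartPoly i) (F.comp (i.succAbove k))
        - MvPolynomial.X k * MvPolynomial.aeval (chartPoly i) (F.comp i)) := by
    intro k
    ext w
    rw [map_sub, map_mul, eval_aeval_chartPoly, eval_aeval_chartPoly, MvPolynomial.eval_X]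
    rfl
  have hd : HasFDerivAt (F.chartField i) (ContinuousLinearMap.pi fun k =>
      ∑ l, MvPolynomial.eval w (MvPolynomial.pderiv l
        (MvPolynomial.aeval (chartPoly i) (F.comp (i.succAbove k))
        - MvPolynomial.X k * MvPolynomial.aeval (chartPoly i) (F.comp i))) •
        (ContinuousLinearMap.proj l : (Fin 2 → ℂ) →L[ℂ] ℂ)) w := by
    rw [hasFDerivAt_pi]
    intro k
    rw [hfield k]
    exact hasFDerivAt_eval _ w
  rw [hd.fderiv, ← sum_pderiv_chartPoly, ← sum_pderiv_chartPoly, ← eval_aeval_chartPoly]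
  simp only [ContinuousLinearMap.pi_apply, sum_apply, smul_apply, ContinuousLinearMap.proj_apply,
    smul_eq_mul]
  have h1 : f k = ∑ l, MvPolynomial.eval w (MvPolynomial.pderiv l (MvPolynomial.X k)) * f l := by
    rw [Finset.sum_eq_single k]
    · simp
    · intro b _ hb
      simp [MvPolynomial.pderiv_X, hb.symm]
    · simp
  conv_rhs => rw [h1]
  rw [Finset.sum_mul, Finset.mul_sum, ← Finset.sum_sub_distrib, ← Finset.sum_sub_distrib]
  refine Finset.sum_congr rfl fun l _ => ?_
  simp only [map_sub, Derivation.leibniz, smul_eq_mul, map_add, map_mul, MvPolynomial.eval_X]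
  ring

/-- The factor is `c ^ n * c⁻¹` rather than `c ^ (n - 1)`, so that it keeps the same form in degree
zero, where both sides vanish. -/
theorem eval_smul_pderiv {P : MvPolynomial (Fin 3) ℂ} {n : ℕ} (hP : P.IsHomogeneous n) {c : ℂ}
    (hc : c ≠ 0) (u : Fin 3 → ℂ) (j : Fin 3) :
    MvPolynomial.eval (c • u) (MvPolynomial.pderiv j P) =
      c ^ n * c⁻¹ * MvPolynomial.eval u (MvPolynomial.pderiv j P) := by
  rcases n with _ | n
  · rw [← MvPolynomial.totalDegree_zero_iff_isHomogeneous,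
      MvPolynomial.totalDegree_eq_zero_iff_eq_C] at hP
    rw [hP, MvPolynomial.pderiv_C, map_zero, map_zero, mul_zero]
  · rw [eval_smul_of_isHomogeneous hP.pderiv, pow_succ, mul_inv_cancel_right₀ hc]
    rfl

theorem det_ne_zero_of_chart {i : Fin 3} {v : Fin 3 → ℂ} (hv : v i ≠ 0) {f₁ f₂ : Fin 2 → ℂ}
    (hf : f₁ 0 * f₂ 1 - f₁ 1 * f₂ 0 ≠ 0) :
    IsUnit (Matrix.of ![v, Fin.insertNth (α := fun _ => ℂ) i 0 f₁,
      Fin.insertNth (α := fun _ => ℂ) i 0 f₂]).det := by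
  rw [isUnit_iff_ne_zero]
  intro h
  refine mul_ne_zero hv hf ?_
  have e0 : ∀ f : Fin 2 → ℂ, Fin.insertNth (α := fun _ => ℂ) 0 0 f = ![0, f 0, f 1] := fun f => by
    ext l; fin_cases l <;> rfl
  have e1 : ∀ f : Fin 2 → ℂ, Fin.insertNth (α := fun _ => ℂ) 1 0 f = ![f 0, 0, f 1] := fun f => by
    ext l; fin_cases l <;> rfl
  have e2 : ∀ f : Fin 2 → ℂ, Fin.insertNth (α := fun _ => ℂ) 2 0 f = ![f 0, f 1, 0] := fun f => by
    ext l; fin_cases l <;> rfl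
  rw [Matrix.det_fin_three] at h
  obtain rfl | rfl | rfl : i = 0 ∨ i = 1 ∨ i = 2 := by fin_cases i <;> simp
  · simp only [e0] at h
    simp at h
    linear_combination h
  · simp only [e1] at h
    simp at h
    linear_combination -h
  · simp only [e2] at h
    simp at h
    linear_combination h

/-- Eigenvectors in the chart, completed by a zero `i`-th coordinate, are eigenvectors of the
derivative of `F` modulo the radial direction. Passing from the chart point `u` to `v = c u`
multiplies both eigenvalues by `c ^ d * c⁻¹`, so their quotient is unchanged. -/
theorem isHyperbolicVector (hF : F.HasOnlyHyperbolicSingularities) (v : Fin 3 → ℂ) (hv : v ≠ 0)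
    (hpar : ∃ μ : ℂ, ∀ i, MvPolynomial.eval v (F.comp i) = μ * v i) :
    IsHyperbolicVector F.comp v := by
  obtain ⟨i, hi⟩ := Function.ne_iff.1 hv
  rw [Pi.zero_apply] at hi
  set c := v i with hc
  set w : Fin 2 → ℂ := fun k => c⁻¹ * v (i.succAbove k) with hw
  set u := chartPoint i w with hu
  have hui : u i = 1 := by simp [hu, chartPoint]
  have huk : ∀ k, u (i.succAbove k) = w k := fun k => by simp [hu, chartPoint]
  have hvu : v = c • u := by
    ext l
    rcases Fin.eq_self_or_eq_succAbove i l with rfl | ⟨k, rfl⟩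
    · rw [Pi.smul_apply, hui, smul_eq_mul, mul_one]
    · rw [Pi.smul_apply, huk, smul_eq_mul, hw, mul_inv_cancel_left₀ hi]
  obtain ⟨μ, hμ⟩ := hpar
  have hsing : Projectivization.mk ℂ v hv ∈ F.Sing := by
    intro x hx
    obtain ⟨a, rfl⟩ := (mem_mk_submodule hv).1 hx
    refine (mem_mk_submodule hv).2 ⟨a ^ d * μ, ?_⟩
    ext l
    simp only [field, eval_smul_of_isHomogeneous (F.homogeneous l), hμ, Pi.smul_apply, smul_eq_mul]
    ring
  obtain ⟨l₁, l₂, hroots, h1, h2, him⟩ := hF _ hsing i w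
    ((mem_mk_submodule hv).2 ⟨c⁻¹, by rw [hvu, smul_smul, inv_mul_cancel₀ hi, one_smul]⟩)
  set T := (fderiv ℂ (F.chartField i) w : (Fin 2 → ℂ) →ₗ[ℂ] (Fin 2 → ℂ)) with hT
  have heig : ∀ l ∈ T.charpoly.roots, ∃ f : Fin 2 → ℂ, f ≠ 0 ∧ T f = l • f := by
    intro l hl
    have h := (Module.End.hasEigenvalue_iff_isRoot_charpoly T l).2
      (Polynomial.isRoot_of_mem_roots hl)
    obtain ⟨f, hf⟩ := h.exists_hasEigenvector
    exact ⟨f, hf.2, hf.apply_eq_smul⟩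
  obtain ⟨f₁, hf₁, hTf₁⟩ := heig l₁ (by rw [hroots]; simp)
  obtain ⟨f₂, hf₂, hTf₂⟩ := heig l₂ (by rw [hroots]; simp)
  -- Proportional eigenvectors would have equal eigenvalues, with real quotient 1.
  have hdet : f₁ 0 * f₂ 1 - f₁ 1 * f₂ 0 ≠ 0 := by
    intro h0
    obtain ⟨k, hk⟩ := Function.ne_iff.1 hf₁
    rw [Pi.zero_apply] at hk
    have hprop : f₂ = (f₂ k / f₁ k) • f₁ := by
      ext l
      rw [Pi.smul_apply, smul_eq_mul, div_mul_eq_mul_div, eq_div_iff hk]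
      fin_cases k <;> fin_cases l <;> simp only [Fin.zero_eta, Fin.mk_one] <;>
        first
        | rfl
        | linear_combination h0
        | linear_combination -h0
    have h3 : T f₂ = l₁ • f₂ := by
      rw [hprop, map_smul, hTf₁, smul_comm]
    rw [hTf₂] at h3
    have h4 : l₂ = l₁ := smul_left_injective ℂ hf₂ h3
    rw [h4, div_self h1] at him
    exact him Complex.one_im
  set ν := c ^ d * c⁻¹ with hν
  have hν0 : ν ≠ 0 := mul_ne_zero (pow_ne_zero _ hi) (inv_ne_zero hi)
  have hFv : ∀ l, MvPolynomial.eval v (F.comp l) = c ^ d * MvPolynomial.eval u (F.comp l) :=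
    fun l => by rw [hvu, eval_smul_of_isHomogeneous (F.homogeneous l)]
  have hμu : μ = ν * MvPolynomial.eval u (F.comp i) := by
    have h := hμ i
    rw [hFv, ← hc] at h
    rw [hν]
    field_simp
    linear_combination -h
  have hDv : ∀ l j, MvPolynomial.eval v (MvPolynomial.pderiv j (F.comp l)) =
      ν * MvPolynomial.eval u (MvPolynomial.pderiv j (F.comp l)) := fun l j => by
    rw [hvu, eval_smul_pderiv (F.homogeneous l) hi]
  have hvec : ∀ (l : ℂ) (f : Fin 2 → ℂ), T f = l • f →
      ∀ m, ∑ j, Fin.insertNth (α := fun _ => ℂ) i 0 f j *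
          MvPolynomial.eval v (MvPolynomial.pderiv j (F.comp m)) =
        (μ + ν * l) * Fin.insertNth (α := fun _ => ℂ) i 0 f m +
        (ν * c⁻¹ * ∑ j, Fin.insertNth (α := fun _ => ℂ) i 0 f j *
          MvPolynomial.eval u (MvPolynomial.pderiv j (F.comp i))) * v m := by
    intro l f hf m
    simp only [hDv, mul_left_comm _ ν, ← Finset.mul_sum]
    rcases Fin.eq_self_or_eq_succAbove i m with rfl | ⟨k, rfl⟩
    · rw [Fin.insertNth_apply_same, ← hc]
      field_simp
      ring
    · have hk := congrFun hf k
      rw [hT, ContinuousLinearMap.coe_coe, fderiv_chartField, Pi.smul_apply, smul_eq_mul,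
        ← hu] at hk
      rw [Fin.insertNth_apply_succAbove, hμu]
      have hvk : v (i.succAbove k) = c * w k := by rw [hw, mul_inv_cancel_left₀ hi]
      rw [hvk]
      have hcc : c⁻¹ * c = 1 := inv_mul_cancel₀ hi
      linear_combination ν * hk - ν * w k * (∑ j, Fin.insertNth (α := fun _ => ℂ) i 0 f j *
          MvPolynomial.eval u (MvPolynomial.pderiv j (F.comp i))) * hcc
  refine ⟨Fin.insertNth (α := fun _ => ℂ) i 0 f₁, Fin.insertNth (α := fun _ => ℂ) i 0 f₂, μ,
    ν * l₁, ν * l₂, _, _, det_ne_zero_of_chart hi hdet, ?_, hμ, hvec l₁ f₁ hTf₁, hvec l₂ f₂ hTf₂⟩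
  rwa [mul_div_mul_left _ _ hν0]

end PlaneFoliation

/-! ### Finiteness and the bound on the sum of degrees -/

theorem proposition2 (d : ℕ) (F : PlaneFoliation d) (hF : F.HasOnlyHyperbolicSingularities) :
    ∃ hfin : F.invariantCurves.Finite,
      ∑ C ∈ hfin.toFinset, curveDegree C ≤ 2 * (d + 2) := by
  classical
  have hcurve : ∀ C : Set P2, ∃ (n : ℕ) (h : MvPolynomial (Fin 3) ℂ), C ∈ F.invariantCurves →
      h.IsHomogeneous n ∧ Irreducible h ∧ projZeroLocus h = C := by
    intro C
    by_cases hC : C ∈ F.invariantCurves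
    · obtain ⟨n, h, hh⟩ := hC.1
      exact ⟨n, h, fun _ => hh⟩
    · exact ⟨0, 0, fun h => absurd h hC⟩
  choose n h hh using hcurve
  have hbound : ∀ s : Finset (Set P2), ↑s ⊆ F.invariantCurves → ∑ C ∈ s, n C ≤ d + 2 := by
    intro s hs
    have hs' : ∀ C ∈ s, C ∈ F.invariantCurves := fun C hC => hs hC
    -- Associated equations have the same zero set, so distinct curves have coprime equations.
    have hsq : Squarefree (∏ C ∈ s, h C) := by
      refine Finset.squarefree_prod_of_pairwise_isCoprime ?_
        fun C hC => (hh C (hs' C hC)).2.1.squarefree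
      intro C hC C' hC' hne
      obtain ⟨-, hirr, hloc⟩ := hh C (hs hC)
      obtain ⟨-, hirr', hloc'⟩ := hh C' (hs hC')
      rw [Function.onFun, hirr.isRelPrime_iff_not_dvd]
      intro hdvd
      obtain ⟨a, ha⟩ := (hirr.dvd_irreducible_iff_associated hirr').1 hdvd
      apply hne
      rw [← hloc, ← hloc', ← ha]
      ext p
      refine forall₂_congr fun v _ => ?_
      have hu : IsUnit (MvPolynomial.eval v (a : MvPolynomial (Fin 3) ℂ)) :=
        a.isUnit.map (MvPolynomial.eval v)
      rw [map_mul, mul_eq_zero, or_iff_left hu.ne_zero]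
    have hhom : (∏ C ∈ s, h C).IsHomogeneous (∑ C ∈ s, n C) :=
      MvPolynomial.IsHomogeneous.prod _ _ _ fun C hC => (hh C (hs' C hC)).1
    have hDapply : ∀ p, (∑ i, F.comp i • (MvPolynomial.pderiv i :
        Derivation ℂ (MvPolynomial (Fin 3) ℂ) (MvPolynomial (Fin 3) ℂ))) p
        = ∑ i, F.comp i * MvPolynomial.pderiv i p := by
      intro p
      simp [Fin.sum_univ_three]
    have hdvd := prod_dvd_derivation_prod (∑ i, F.comp i • (MvPolynomial.pderiv i :
        Derivation ℂ (MvPolynomial (Fin 3) ℂ) (MvPolynomial (Fin 3) ℂ))) s h fun C hC => by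
      obtain ⟨hhomC, hirr, hloc⟩ := hh C (hs' C hC)
      rw [hDapply]
      refine F.dvd_field_gradient hhomC hirr ?_
      rw [hloc]
      exact (hs' C hC).2
    rw [hDapply] at hdvd
    obtain ⟨K, hK⟩ := hdvd
    exact degree_le_of_invariant F.homogeneous hsq hhom (K := K) (by rw [hK, mul_comm])
      (F.isHyperbolicVector hF)
  have hpos : ∀ C ∈ F.invariantCurves, 1 ≤ n C := fun C hC =>
    Nat.one_le_iff_ne_zero.2 (isHomogeneous_ne_zero_of_irreducible (hh C hC).1 (hh C hC).2.1)
  have hfin : F.invariantCurves.Finite := by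
    by_contra hinf
    -- Every equation has positive degree, so `d + 3` curves would already exceed the bound.
    obtain ⟨s, hs, hcard⟩ := Set.Infinite.exists_subset_card_eq hinf (d + 3)
    have h1 := hbound s hs
    have h2 : s.card ≤ ∑ C ∈ s, n C := by
      rw [Finset.card_eq_sum_ones]
      exact Finset.sum_le_sum fun C hC => hpos C (hs hC)
    omega
  refine ⟨hfin, ?_⟩
  have h1 := hbound hfin.toFinset (by simp)
  -- `curveDegree` is an infimum, so the degree of any chosen equation bounds it from above.
  have h2 : ∑ C ∈ hfin.toFinset, curveDegree C ≤ ∑ C ∈ hfin.toFinset, n C := by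
    refine Finset.sum_le_sum fun C hC => Nat.sInf_le ?_
    obtain ⟨hhomC, hirr, hloc⟩ := hh C (hfin.mem_toFinset.1 hC)
    exact ⟨h C, hirr.ne_zero, hhomC, hloc⟩
  omega
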